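/- **Setting.** A topological groupoid $\mathsf G$ has spaces $\mathsf G_0,\mathsf G_1$ of objects and arrows and continuous structure maps; $a\cdot b$ is defined when $t(a)=s(b)$. A morphism $\Psi:\mathsf H\to\mathsf G$ (a pair of continuous maps commuting with the structure maps) is *Morita* if $$\mathsf H_1\cong(\mathsf H_0\times\mathsf H_0)\times_{\mathsf G_0\times\mathsf G_0}\mathsf G_1$$ via $(s,t)$ and $\Psi_1$ (the square is cartesian in topological spaces) and $s\circ\pi_2:\mathsf H_0\,{}_{\Psi_0}\!\times_t\mathsf G_1\to\mathsf G_0$ is an open surjection. $\mathsf G$ and $\mathsf H$ are *Morita equivalent* if there are a topological groupoid $\mathsf K$ and Morita morphisms $\mathsf G\leftarrow\mathsf K\to\mathsf H$. The *inertia groupoid* $\wedge\mathsf G$ has as objects the $v\in\mathsf G_1$ with $s(v)=t(v)$, and as arrows $v\to w$ the $\alpha\in\mathsf G_1$ with $v\cdot\alpha=\alpha\cdot w$ (subspace topologies). An *orbifold chart* $(V,G,\pi)$ of a space $X$ is a connected smooth $n$-manifold $V$ with a smooth effective action of a finite group $G$ and a map $\pi:V\to X$ inducing a homeomorphism of $V/G$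 onto an open subset of $X$. An *embedding* $(\lambda,\varphi):(W,H,\rho)\to(V,G,\pi)$ is a smooth open embedding $\lambda:W\to V$ with $\pi\lambda=\rho$, equivariant along a monomorphism $\varphi:H\to G$. An ($n$-dimensional, effective) *orbifold structure* on a paracompact Hausdorff space $X$ is a family of charts $(V_p,G_p,\pi_p)_{p\in X}$ with $p\in\pi_p(V_p)$ such that, whenever $q\in\pi_p(V_p)$, some chart whose image contains $q$ embeds into both $V_p$ and $V_q$. The groupoid $\mathsf X$ associated with the orbifold has $\mathsf X_0=\bigsqcup_p V_p$; its arrows from $x\in V_p$ to $y\in V_q$ are classes $[\lambda_1,w,\lambda_2]$, where $\lambda_1:W\to V_p$ and $\lambda_2:W\to V_q$ are embeddings of a chart $W$, $w\in W$, $\lambda_1(w)=x$, $\lambda_2(w)=y$, for the equivalence relation generated by $(\lambda_1\nu,w',\lambda_2\nu)\sim(\lambda_1,\nu(w'),\lambda_2)$ with $\nu:W'\to W$ an embedding; $\mathsf X_1$ has the quotient topology from the disjoint union of the $W$'s. Further, $[\lambda_1,w,\lambda_2]\cdot[\mu_1,z,\mu_2]=[\lambda_1\nu,y,\mu_2\mu]$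 if $\nu,\mu$ are embeddings with $\lambda_2\nu=\mu_1\mu$, $\nu(y)=w$, $\mu(y)=z$. Fix a representative $g$ of each conjugacy class $(g)\subset G_p$, for every $p$. The *twisted-sector groupoid* $\widetilde{\Sigma_1X}$ has as objects $\bigsqcup_p\bigsqcup_{(g)\subset G_p}V_p^g\times\{g\}$; its arrows from $(x,g)$, $x\in V_p^g$, to $(y,h)$, $y\in V_q^h$, are classes $[\lambda_1,w,\lambda_2]$ of triples as above for which there is $k\in H$ (where $H$ is the group of $W$) with $\varphi_1(k)=g$, $\varphi_2(k)=h$ and $w\in W^k$, modulo refinement by embeddings $\nu:W'\to W$ respecting the elements $k',k$ and points of $W'^{k'}$; the topology and the composition are as for $\mathsf X$, with $W^k$ in place of $W$. **Proposition.** Let $X$ be an orbifold with associated groupoid $\mathsf X$, and let representatives of the conjugacy classes be chosen arbitrarily. 1. The inertia groupoid $\wedge\mathsf X$ is Morita equivalent to $\widetilde{\Sigma_1X}$. 2. $\widetilde{\Sigma_1X}$ is a subgroupoid of $\wedge\mathsf X$, and there are morphisms $$\widetilde{\Sigma_1X}\overset{\iota}{\hookrightarrow}\wedge\mathsf X\overset{M}{\longrightarrow}\widetilde{\Sigma_1X}$$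 of topological groupoids in which $M$ is Morita and $\iota$ is a topological embedding on objects and on arrows, given by $(x,g)\mapsto[\mathrm{id},x,\lambda_g]$ on objects, where $\lambda_g(y)=gy$, and by $[\lambda_1,w,\lambda_2]\mapsto[\lambda_1,w,\lambda_2]$ on arrows. 3. For every $p\in X$, $\widetilde{\Sigma_1X}$ restricted to the objects over $p$ is $\bigsqcup_{(g)\subset G_p}\big(V_p^g\times C_{G_p}(g)\rightrightarrows V_p^g\big)$: the map $(x,z)\mapsto[\mathrm{id},x,\lambda_z]$ is an open embedding of $\bigsqcup_{(g)}V_p^g\times C_{G_p}(g)$ into the space of arrows, whose image is the set of all arrows with source and target over $p$. -/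

import Mathlib

open CategoryTheory Topology Manifold ContDiff

universe u v w w₁

/-! ## Topological groupoids

Composition is written in diagrammatic order: `G.comp a b` is defined when the target of `a`
is the source of `b`. -/

/-- A topological groupoid (a small category with all arrows invertible, with topologies on objects
and arrows for which all structure maps are continuous). -/
structure TopGroupoid where
  Obj : Type u
  Arr : Type v
  [topObj : TopologicalSpace Obj]
  [topArr : TopologicalSpace Arr]
  src : Arr → Obj
  tgt : Arr → Obj
  one : Obj → Arr
  inv : Arr → Arr
  comp : ∀ a b : Arr, tgt a = src b → Arr
  src_one : ∀ x, src (one x) = x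
  tgt_one : ∀ x, tgt (one x) = x
  src_inv : ∀ a, src (inv a) = tgt a
  tgt_inv : ∀ a, tgt (inv a) = src a
  src_comp : ∀ a b h, src (comp a b h) = src a
  tgt_comp : ∀ a b h, tgt (comp a b h) = tgt b
  one_comp : ∀ a, comp (one (src a)) a (tgt_one _) = a
  comp_one : ∀ a, comp a (one (tgt a)) (src_one _).symm = a
  assoc : ∀ a b c (h : tgt a = src b) (h' : tgt b = src c),
    comp (comp a b h) c ((tgt_comp a b h).trans h') =
      comp a (comp b c h') (h.trans (src_comp b c h').symm)
  comp_inv : ∀ a, comp a (inv a) (src_inv a).symm = one (src a)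
  inv_comp : ∀ a, comp (inv a) a (tgt_inv a) = one (tgt a)
  continuous_src : Continuous src
  continuous_tgt : Continuous tgt
  continuous_one : Continuous one
  continuous_inv : Continuous inv
  continuous_comp :
    Continuous fun p : {p : Arr × Arr // tgt p.1 = src p.2} => comp p.1.1 p.1.2 p.2

namespace TopGroupoid

attribute [instance] topObj topArr

/-- A morphism of topological groupoids: a pair of continuous maps commuting with the structure
maps. -/
structure Hom (G : TopGroupoid.{u, v}) (H : TopGroupoid.{w, w₁}) where
  obj : G.Obj → H.Obj
  arr : G.Arr → H.Arr
  continuous_obj : Continuous obj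
  continuous_arr : Continuous arr
  src_arr : ∀ a, H.src (arr a) = obj (G.src a)
  tgt_arr : ∀ a, H.tgt (arr a) = obj (G.tgt a)
  arr_one : ∀ x, arr (G.one x) = H.one (obj x)
  arr_inv : ∀ a, arr (G.inv a) = H.inv (arr a)
  arr_comp : ∀ a b (h : G.tgt a = G.src b), arr (G.comp a b h) =
    H.comp (arr a) (arr b) ((tgt_arr a).trans ((congrArg obj h).trans (src_arr b).symm))

/-- A Morita morphism: the square formed by the arrow map, the anchor maps and the object map
is cartesian (in topological spaces), and `s ∘ π₂ : G₀ ×_{H₀} H₁ → H₀` is an open surjection. -/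
structure Hom.IsMorita {G : TopGroupoid.{u, v}} {H : TopGroupoid.{w, w₁}} (Φ : Hom G H) :
    Prop where
  cartesian : IsHomeomorph fun a : G.Arr =>
    (⟨((G.src a, G.tgt a), Φ.arr a), (Φ.src_arr a).symm, (Φ.tgt_arr a).symm⟩ :
      {p : (G.Obj × G.Obj) × H.Arr //
        Φ.obj p.1.1 = H.src p.2 ∧ Φ.obj p.1.2 = H.tgt p.2})
  isOpenMap : IsOpenMap fun p : {p : G.Obj × H.Arr // Φ.obj p.1 = H.tgt p.2} => H.src p.1.2
  surjective : Function.Surjective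
    fun p : {p : G.Obj × H.Arr // Φ.obj p.1 = H.tgt p.2} => H.src p.1.2

/-- Morita equivalence: a third topological groupoid with Morita morphisms to both. -/
def MoritaEquivalent (G : TopGroupoid.{u, v}) (H : TopGroupoid.{w, w₁}) : Prop :=
  ∃ (K : TopGroupoid.{max u w, max v w₁}) (Φ : Hom K G) (Ψ : Hom K H),
    Φ.IsMorita ∧ Ψ.IsMorita

/-- A morphism exhibiting `G` as a (topological) subgroupoid of `H`. -/
structure Hom.IsSubgroupoidEmbedding {G : TopGroupoid.{u, v}} {H : TopGroupoid.{w, w₁}}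
    (Φ : Hom G H) : Prop where
  obj : IsEmbedding Φ.obj
  arr : IsEmbedding Φ.arr

/-- Objects of the inertia groupoid: the loops of `G`. -/
abbrev Loop (G : TopGroupoid.{u, v}) : Type v := {a : G.Arr // G.src a = G.tgt a}

/-- Arrows `v ⟶ w` of the inertia groupoid: `α ∈ G₁` with `v · α = α · w`. -/
abbrev LoopArr (G : TopGroupoid.{u, v}) : Type v :=
  {p : G.Loop × G.Arr × G.Loop // ∃ (h : G.tgt p.1.1 = G.src p.2.1)
    (h' : G.tgt p.2.1 = G.src p.2.2.1), G.comp p.1.1 p.2.1 h = G.comp p.2.1 p.2.2.1 h'}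

section inertia

variable (G : TopGroupoid.{u, v})

theorem comp_congr {a a' b b' : G.Arr} (ha : a = a') (hb : b = b') (h : G.tgt a = G.src b) :
    G.comp a b h = G.comp a' b' (by rw [← ha, ← hb]; exact h) := by
  subst ha hb; rfl

theorem continuous_comp' {T : Type*} [TopologicalSpace T] {f g : T → G.Arr}
    (hf : Continuous f) (hg : Continuous g) (h : ∀ t, G.tgt (f t) = G.src (g t)) :
    Continuous fun t => G.comp (f t) (g t) (h t) :=
  G.continuous_comp.comp
    (Continuous.subtype_mk (hf.prodMk hg) h : Continuous fun t => (⟨(f t, g t), h t⟩ :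
      {p : G.Arr × G.Arr // G.tgt p.1 = G.src p.2}))

/-- The inertia groupoid `∧G`. -/
def inertia : TopGroupoid.{v, v} where
  Obj := G.Loop
  Arr := G.LoopArr
  src p := p.1.1
  tgt p := p.1.2.2
  one v := ⟨(v, G.one (G.src v.1), v), by
    refine ⟨by rw [G.src_one, v.2], G.tgt_one _, ?_⟩
    rw [G.one_comp, G.comp_congr rfl (congrArg G.one v.2)]
    exact G.comp_one v.1⟩
  inv p := ⟨(p.1.2.2, G.inv p.1.2.1, p.1.1), by
    obtain ⟨⟨v, α, w⟩, h, h', e⟩ := p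
    dsimp only at h h' e ⊢
    have h1 : G.tgt w.1 = G.src (G.inv α) := by rw [G.src_inv, h', w.2]
    have h2 : G.tgt (G.inv α) = G.src v.1 := by rw [G.tgt_inv, v.2, h]
    refine ⟨h1, h2, ?_⟩
    have h3 : G.tgt (G.inv α) = G.src α := G.tgt_inv α
    have e1 : G.comp (G.inv α) (G.comp α w.1 h') (by rw [G.src_comp, h3]) = w.1 := by
      rw [← G.assoc _ _ _ h3 h']
      rw [G.comp_congr (G.inv_comp α) rfl]
      rw [G.comp_congr (congrArg G.one h') rfl]
      exact G.one_comp _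
    have e2 : G.comp (G.comp (G.inv α) v.1 h2) α (by rw [G.tgt_comp, h]) = w.1 := by
      rw [G.assoc _ _ _ h2 h, G.comp_congr rfl e, e1]
    have e3 : G.comp (G.comp (G.comp (G.inv α) v.1 h2) α (by rw [G.tgt_comp, h])) (G.inv α)
        (by rw [G.tgt_comp, G.src_inv]) = G.comp (G.inv α) v.1 h2 := by
      rw [G.assoc _ _ _ (by rw [G.tgt_comp, h]) (G.src_inv α).symm,
        G.comp_congr rfl (G.comp_inv α),
        G.comp_congr rfl (congrArg G.one (h.symm.trans (G.tgt_comp _ _ h2).symm))]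
      exact G.comp_one _
    rw [← e3]
    exact (G.comp_congr e2 rfl _).symm⟩
  comp p q hpq := ⟨(p.1.1, G.comp p.1.2.1 q.1.2.1 (by
      obtain ⟨h, h', e⟩ := p.2
      obtain ⟨k, k', e'⟩ := q.2
      rw [h', hpq, q.1.1.2, k]), q.1.2.2), by
    obtain ⟨⟨v, α, w⟩, h, h', e⟩ := p
    obtain ⟨⟨w', β, x⟩, k, k', e'⟩ := q
    dsimp only at hpq
    subst hpq
    dsimp only at h h' e k k' e' ⊢
    refine ⟨by rw [G.src_comp, h], by rw [G.tgt_comp, k'], ?_⟩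
    have hab : G.tgt α = G.src β := by rw [h', w.2, k]
    rw [← G.assoc _ _ _ h hab, G.comp_congr e rfl, G.assoc _ _ _ h' k, G.comp_congr rfl e',
      G.assoc _ _ _ hab k']⟩
  src_one _ := rfl
  tgt_one _ := rfl
  src_inv _ := rfl
  tgt_inv _ := rfl
  src_comp _ _ _ := rfl
  tgt_comp _ _ _ := rfl
  one_comp p := by
    obtain ⟨⟨v, α, w⟩, h, h', e⟩ := p
    refine Subtype.ext (Prod.ext rfl (Prod.ext ?_ rfl))
    dsimp only at h ⊢
    rw [G.comp_congr (congrArg G.one (v.2.trans h)) rfl]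
    exact G.one_comp α
  comp_one p := by
    obtain ⟨⟨v, α, w⟩, h, h', e⟩ := p
    refine Subtype.ext (Prod.ext rfl (Prod.ext ?_ rfl))
    dsimp only at h' ⊢
    rw [G.comp_congr rfl (congrArg G.one h'.symm)]
    exact G.comp_one α
  assoc p q r h h' := Subtype.ext (Prod.ext rfl (Prod.ext (G.assoc _ _ _ _ _) rfl))
  comp_inv p := by
    obtain ⟨⟨v, α, w⟩, h, h', e⟩ := p
    refine Subtype.ext (Prod.ext rfl (Prod.ext ?_ rfl))
    dsimp only at h ⊢
    rw [G.comp_inv, v.2, h]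
  inv_comp p := by
    obtain ⟨⟨v, α, w⟩, h, h', e⟩ := p
    refine Subtype.ext (Prod.ext rfl (Prod.ext ?_ rfl))
    dsimp only at h' ⊢
    rw [G.inv_comp, h']
  continuous_src := by fun_prop
  continuous_tgt := by fun_prop
  continuous_one := by
    have := G.continuous_src
    have := G.continuous_one
    exact Continuous.subtype_mk (by fun_prop) _
  continuous_inv := by
    have := G.continuous_inv
    exact Continuous.subtype_mk (by fun_prop) _
  continuous_comp := by
    refine Continuous.subtype_mk (Continuous.prodMk (by fun_prop) (Continuous.prodMk ?_
      (by fun_prop))) _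
    exact G.continuous_comp' (by fun_prop) (by fun_prop) _

end inertia

end TopGroupoid

/-! ## The groupoid of spans of chart embeddings -/

/-- A category of charts: every chart has a space of points, every arrow induces an open embedding
of spaces, every arrow is a monomorphism, and two arrows into the same chart that meet in a point
have a common refinement through that point. -/
class ChartCat (C : Type w) [Category.{w₁} C] where
  Pt : C → Type u
  [top : ∀ A, TopologicalSpace (Pt A)]
  map : ∀ {A B : C}, (A ⟶ B) → Pt A → Pt B
  map_id : ∀ {A : C} (x : Pt A), map (𝟙 A) x = x
  map_comp : ∀ {A B D : C} (f : A ⟶ B) (g : B ⟶ D) (x : Pt A), map (f ≫ g) x = map g (map f x)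
  isOpenEmbedding_map : ∀ {A B : C} (f : A ⟶ B), IsOpenEmbedding (map f)
  mono : ∀ {A B : C} (f : A ⟶ B), Mono f
  refine : ∀ {A B D : C} (f : A ⟶ D) (g : B ⟶ D) (a : Pt A) (b : Pt B), map f a = map g b →
    ∃ (R : C) (r : Pt R) (f' : R ⟶ A) (g' : R ⟶ B),
      map f' r = a ∧ map g' r = b ∧ f' ≫ f = g' ≫ g

attribute [reducible, instance] ChartCat.top

namespace ChartCat

variable {C : Type w} [Category.{w₁} C] [ChartCat.{u} C] {I : Type v}

/-- A span `V i ⟵ A ⟶ V j` of embeddings of charts. -/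
structure Span (V : I → C) where
  i : I
  j : I
  apex : C
  left : apex ⟶ V i
  right : apex ⟶ V j

/-- A triple `(λ₁, a, λ₂)`: a span together with a point of its apex. The set of all triples
carries the topology of the disjoint union of the apices. -/
abbrev Triple (V : I → C) := Σ S : Span V, Pt.{u} S.apex

variable {V : I → C}

/-- The triple `(νλ₁, b, νλ₂)` refines the triple `(λ₁, ν(b), λ₂)`. -/
inductive Refines : Triple V → Triple V → Prop
  | mk (i j : I) (A B : C) (l : A ⟶ V i) (r : A ⟶ V j) (ν : B ⟶ A) (l' : B ⟶ V i) (r' : B ⟶ V j)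
      (b : Pt.{u} B) (a : Pt.{u} A) (h : map ν b = a) (hl : ν ≫ l = l') (hr : ν ≫ r = r') :
      Refines ⟨⟨i, j, B, l', r'⟩, b⟩ ⟨⟨i, j, A, l, r⟩, a⟩

variable (V) in
/-- Equivalence classes `[λ₁, a, λ₂]` of triples, for the equivalence relation generated by
refinement, with the quotient topology. -/
abbrev SpanArr := Quot (Refines (V := V))

theorem Refines.refl (S : Triple V) : Refines S S := by
  obtain ⟨⟨i, j, A, l, r⟩, a⟩ := S
  exact Refines.mk i j A A l r (𝟙 A) _ _ a a (map_id a) (Category.id_comp _) (Category.id_comp _)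

theorem Refines.trans {S T U : Triple V} (h : Refines S T) (h' : Refines T U) : Refines S U := by
  cases h' with
  | mk i j A B l r ν l' r' b a e hl hr =>
    cases h with
    | mk _ _ _ D _ _ μ l'' r'' d _ e' hl' hr' =>
      exact Refines.mk i j A D l r (μ ≫ ν) _ _ d a (by rw [map_comp, e', e])
        (by rw [Category.assoc, hl, hl']) (by rw [Category.assoc, hr, hr'])

theorem Refines.ore {S T U : Triple V} (h : Refines S U) (h' : Refines T U) :
    ∃ W, Refines W S ∧ Refines W T := by
  cases h with
  | mk i j A B l r ν l₁ r₁ b a e hl hr =>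
    cases h' with
    | mk _ _ _ D _ _ μ l₂ r₂ d _ e' hl' hr' =>
      obtain ⟨R, x, f, g, hf, hg, sq⟩ := ChartCat.refine ν μ b d (e.trans e'.symm)
      refine ⟨⟨⟨i, j, R, f ≫ l₁, f ≫ r₁⟩, x⟩, Refines.mk _ _ _ _ _ _ _ _ _ _ _ hf rfl rfl,
        Refines.mk _ _ _ _ _ _ g _ _ _ _ hg ?_ ?_⟩
      · rw [← hl, ← hl', ← Category.assoc, ← Category.assoc, sq]
      · rw [← hr, ← hr', ← Category.assoc, ← Category.assoc, sq]

theorem mk_eq_iff {S T : Triple V} :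
    (Quot.mk _ S : SpanArr V) = Quot.mk _ T ↔ ∃ W, Refines W S ∧ Refines W T := by
  constructor
  · intro h
    rw [Quot.eq] at h
    induction h with
    | rel x y h => exact ⟨x, Refines.refl x, h⟩
    | refl x => exact ⟨x, Refines.refl x, Refines.refl x⟩
    | symm x y _ ih => exact ⟨ih.choose, ih.choose_spec.2, ih.choose_spec.1⟩
    | trans x y z _ _ ih ih' =>
      obtain ⟨W, h1, h2⟩ := ih
      obtain ⟨W', h1', h2'⟩ := ih'
      obtain ⟨Z, k1, k2⟩ := h2.ore h1'
      exact ⟨Z, k1.trans h1, k2.trans h2'⟩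
  · rintro ⟨W, h, h'⟩
    exact (Quot.sound h).symm.trans (Quot.sound h')

/-- Source of a triple. -/
def Triple.src (S : Triple V) : Σ i, Pt.{u} (V i) := ⟨S.1.i, map S.1.left S.2⟩
/-- Target of a triple. -/
def Triple.tgt (S : Triple V) : Σ i, Pt.{u} (V i) := ⟨S.1.j, map S.1.right S.2⟩
/-- The triple `(λ₂, a, λ₁)`. -/
def Triple.swap (S : Triple V) : Triple V := ⟨⟨S.1.j, S.1.i, S.1.apex, S.1.right, S.1.left⟩, S.2⟩
/-- The triple `(id, x, id)`. -/
def Triple.one (x : Σ i, Pt.{u} (V i)) : Triple V := ⟨⟨x.1, x.1, V x.1, 𝟙 _, 𝟙 _⟩, x.2⟩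

theorem Refines.src_eq {S T : Triple V} (h : Refines S T) : S.src = T.src := by
  cases h with
  | mk i j A B l r ν l' r' b a e hl hr => simp [Triple.src, map_comp, e, ← hl]

theorem Refines.tgt_eq {S T : Triple V} (h : Refines S T) : S.tgt = T.tgt := by
  cases h with
  | mk i j A B l r ν l' r' b a e hl hr => simp [Triple.tgt, map_comp, e, ← hr]

theorem Refines.swap {S T : Triple V} (h : Refines S T) : Refines S.swap T.swap := by
  cases h with
  | mk i j A B l r ν l' r' b a e hl hr => exact Refines.mk _ _ _ _ _ _ _ _ _ _ _ e hr hl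

/-- `[λ₁ν, d, μ₂μ]` is the composite of `[λ₁, a, λ₂]` and `[μ₁, b, μ₂]` whenever
`ν(d) = a`, `μ(d) = b` and `λ₂ν = μ₁μ`. -/
inductive Composite : Triple V → Triple V → Triple V → Prop
  | mk (i j k : I) (A B D : C) (l : A ⟶ V i) (r : A ⟶ V j) (m : B ⟶ V j) (n : B ⟶ V k)
      (ν : D ⟶ A) (μ : D ⟶ B) (a : Pt.{u} A) (b : Pt.{u} B) (d : Pt.{u} D)
      (ha : map ν d = a) (hb : map μ d = b) (sq : ν ≫ r = μ ≫ m) :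
      Composite ⟨⟨i, j, A, l, r⟩, a⟩ ⟨⟨j, k, B, m, n⟩, b⟩ ⟨⟨i, k, D, ν ≫ l, μ ≫ n⟩, d⟩

theorem Composite.exists {S T : Triple V} (h : S.tgt = T.src) : ∃ R, Composite S T R := by
  obtain ⟨⟨i, j, A, l, r⟩, a⟩ := S
  obtain ⟨⟨j', k, B, m, n⟩, b⟩ := T
  obtain ⟨h1, h2⟩ := Sigma.mk.inj_iff.1 h
  dsimp only at h1
  subst h1
  obtain ⟨D, d, ν, μ, ha, hb, sq⟩ := ChartCat.refine r m a b (eq_of_heq h2)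
  exact ⟨_, Composite.mk i j k A B D l r m n ν μ a b d ha hb sq⟩

theorem Composite.tgt_eq_src {S T R : Triple V} (h : Composite S T R) : S.tgt = T.src := by
  cases h with
  | mk i j k A B D l r m n ν μ a b d ha hb sq =>
    simp only [Triple.tgt, Triple.src, ← ha, ← hb, ← map_comp, sq]

theorem Composite.src_eq {S T R : Triple V} (h : Composite S T R) : R.src = S.src := by
  cases h with
  | mk i j k A B D l r m n ν μ a b d ha hb sq => simp [Triple.src, map_comp, ha]

theorem Composite.tgt_eq {S T R : Triple V} (h : Composite S T R) : R.tgt = T.tgt := by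
  cases h with
  | mk i j k A B D l r m n ν μ a b d ha hb sq => simp [Triple.tgt, map_comp, hb]

theorem Composite.unique {S T R R' : Triple V} (h : Composite S T R) (h' : Composite S T R') :
    (Quot.mk _ R : SpanArr V) = Quot.mk _ R' := by
  cases h with
  | mk i j k A B D l r m n ν μ a b d ha hb sq =>
    cases h' with
    | mk _ _ _ _ _ D' _ _ _ _ ν' μ' _ _ d' ha' hb' sq' =>
      obtain ⟨E, e, σ, τ, hσ, hτ, w⟩ := ChartCat.refine ν ν' d d' (ha.trans ha'.symm)
      have w' : σ ≫ μ = τ ≫ μ' := by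
        have := ChartCat.mono m
        rw [← cancel_mono m, Category.assoc, Category.assoc, ← sq, ← sq', ← Category.assoc, w,
          Category.assoc]
      rw [mk_eq_iff]
      refine ⟨⟨⟨i, k, E, σ ≫ ν ≫ l, σ ≫ μ ≫ n⟩, e⟩,
        Refines.mk _ _ _ _ _ _ _ _ _ _ _ hσ rfl rfl, Refines.mk _ _ _ _ _ _ τ _ _ _ _ hτ ?_ ?_⟩
      · rw [← Category.assoc, ← w, Category.assoc]
      · rw [← Category.assoc, ← w', Category.assoc]

theorem Composite.of_refines_left {S S' T R : Triple V} (h : Refines S' S)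
    (h' : Composite S' T R) : Composite S T R := by
  cases h with
  | mk i j A B l r κ l₁ r₁ b a e hl hr =>
    subst hl hr
    generalize hQ : (⟨⟨i, j, B, κ ≫ l, κ ≫ r⟩, b⟩ : Triple V) = Q at h'
    cases h' with
    | mk i' j' k A' B' D l' r' m n ν μ a' b' d ha hb sq =>
      cases hQ
      rw [← Category.assoc]
      exact Composite.mk _ _ _ _ _ _ _ _ _ _ _ _ _ _ _ (by rw [map_comp, ha, e]) hb
        (by rw [Category.assoc, sq])

theorem Composite.of_refines_right {S T T' R : Triple V} (h : Refines T' T)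
    (h' : Composite S T' R) : Composite S T R := by
  cases h with
  | mk i j A B l r κ l₁ r₁ b a e hl hr =>
    subst hl hr
    generalize hQ : (⟨⟨i, j, B, κ ≫ l, κ ≫ r⟩, b⟩ : Triple V) = Q at h'
    cases h' with
    | mk i' j' k A' B' D l' r' m n ν μ a' b' d ha hb sq =>
      cases hQ
      rw [← Category.assoc μ κ r]
      exact Composite.mk _ _ _ _ _ _ _ _ _ _ _ _ _ _ _ ha (by rw [map_comp, hb, e])
        (by rw [Category.assoc, sq])

theorem Composite.well_defined {S S' T T' R R' : Triple V}
    (hS : (Quot.mk _ S : SpanArr V) = Quot.mk _ S')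
    (hT : (Quot.mk _ T : SpanArr V) = Quot.mk _ T')
    (h : Composite S T R) (h' : Composite S' T' R') :
    (Quot.mk _ R : SpanArr V) = Quot.mk _ R' := by
  obtain ⟨S₂, h1, h2⟩ := mk_eq_iff.1 hS
  obtain ⟨T₂, k1, k2⟩ := mk_eq_iff.1 hT
  obtain ⟨Q, hQ⟩ := Composite.exists (S := S₂) (T := T₂)
    (by rw [h1.tgt_eq, k1.src_eq, h.tgt_eq_src])
  exact (h.unique ((hQ.of_refines_left h1).of_refines_right k1)).trans
    (((hQ.of_refines_left h2).of_refines_right k2).unique h')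

def SpanArr.src (a : SpanArr V) : Σ i, Pt.{u} (V i) :=
  Quot.lift Triple.src (fun _ _ h => h.src_eq) a

def SpanArr.tgt (a : SpanArr V) : Σ i, Pt.{u} (V i) :=
  Quot.lift Triple.tgt (fun _ _ h => h.tgt_eq) a

def SpanArr.inv (a : SpanArr V) : SpanArr V :=
  Quot.map Triple.swap (fun _ _ h => h.swap) a

theorem SpanArr.exists_composite (a b : SpanArr V) (h : a.tgt = b.src) :
    ∃ R S T : Triple V, Quot.mk _ S = a ∧ Quot.mk _ T = b ∧ Composite S T R := by
  induction a using Quot.ind with | _ S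
  induction b using Quot.ind with | _ T
  obtain ⟨R, hR⟩ := Composite.exists (S := S) (T := T) h
  exact ⟨R, S, T, rfl, rfl, hR⟩

noncomputable def SpanArr.comp (a b : SpanArr V) (h : a.tgt = b.src) : SpanArr V :=
  Quot.mk _ (SpanArr.exists_composite a b h).choose

theorem SpanArr.comp_mk {S T R : Triple V} (hR : Composite S T R)
    (h : SpanArr.tgt (Quot.mk _ S : SpanArr V) = SpanArr.src (Quot.mk _ T)) :
    SpanArr.comp (Quot.mk _ S) (Quot.mk _ T) h = Quot.mk _ R := by
  obtain ⟨S', T', h1, h2, h3⟩ := (SpanArr.exists_composite _ _ h).choose_spec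
  exact h3.well_defined h1 h2 hR

theorem isOpenMap_mk (S : Span V) :
    IsOpenMap fun x : Pt.{u} S.apex => (Quot.mk _ ⟨S, x⟩ : SpanArr V) := by
  intro U hU
  rw [← isQuotientMap_quot_mk.isOpen_preimage, isOpen_sigma_iff]
  intro T
  rw [isOpen_iff_forall_mem_open]
  rintro y ⟨x, hx, e⟩
  obtain ⟨W, h1, h2⟩ := mk_eq_iff.1 e
  obtain ⟨i, j, A, l, r⟩ := S
  obtain ⟨i', j', A', l', r'⟩ := T
  cases h1 with
  | mk _ _ _ B _ _ ν l₁ r₁ b _ hb hl hr =>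
    cases h2 with
    | mk _ _ _ _ _ _ μ _ _ _ _ hb' hl' hr' =>
      refine ⟨map μ '' (map ν ⁻¹' U), ?_,
        (isOpenEmbedding_map μ).isOpenMap _ (hU.preimage (isOpenEmbedding_map ν).continuous),
        ⟨b, by simpa [hb] using hx, hb'⟩⟩
      rintro _ ⟨c, hc, rfl⟩
      exact ⟨map ν c, hc, mk_eq_iff.2 ⟨⟨⟨i, j, B, l₁, r₁⟩, c⟩,
        Refines.mk _ _ _ _ _ _ _ _ _ _ _ rfl hl hr,
        Refines.mk _ _ _ _ _ _ _ _ _ _ _ rfl hl' hr'⟩⟩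

theorem continuous_mk (S : Span V) :
    Continuous fun x : Pt.{u} S.apex => (Quot.mk _ ⟨S, x⟩ : SpanArr V) :=
  continuous_quot_mk.comp continuous_sigmaMk

theorem SpanArr.continuous_src : Continuous (SpanArr.src : SpanArr V → _) :=
  continuous_quot_lift _ <| continuous_sigma fun S =>
    (continuous_sigmaMk (σ := fun i => Pt.{u} (V i))).comp (isOpenEmbedding_map S.left).continuous

theorem SpanArr.continuous_tgt : Continuous (SpanArr.tgt : SpanArr V → _) :=
  continuous_quot_lift _ <| continuous_sigma fun S =>
    (continuous_sigmaMk (σ := fun i => Pt.{u} (V i))).comp (isOpenEmbedding_map S.right).continuous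

theorem SpanArr.continuous_inv : Continuous (SpanArr.inv : SpanArr V → _) :=
  continuous_quot_lift _ <| continuous_sigma fun S =>
    continuous_mk ⟨S.j, S.i, S.apex, S.right, S.left⟩

theorem SpanArr.continuous_comp :
    Continuous fun p : {p : SpanArr V × SpanArr V // p.1.tgt = p.2.src} =>
      SpanArr.comp p.1.1 p.1.2 p.2 := by
  rw [continuous_iff_continuousAt]
  rintro ⟨⟨α, β⟩, h⟩
  dsimp only at h
  obtain ⟨R, S, T, rfl, rfl, hR⟩ := SpanArr.exists_composite α β h
  cases hR with
  | mk i j k A B D l r m n ν μ a b d ha hb sq =>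
    have hc : ∀ x : Pt.{u} D, Composite (V := V) ⟨⟨i, j, A, l, r⟩, map ν x⟩
        ⟨⟨j, k, B, m, n⟩, map μ x⟩ ⟨⟨i, k, D, ν ≫ l, μ ≫ n⟩, x⟩ := fun x =>
      Composite.mk _ _ _ _ _ _ _ _ _ _ _ _ _ _ _ rfl rfl sq
    let g : Pt.{u} D → {p : SpanArr V × SpanArr V // p.1.tgt = p.2.src} := fun x =>
      ⟨(Quot.mk _ ⟨⟨i, j, A, l, r⟩, map ν x⟩, Quot.mk _ ⟨⟨j, k, B, m, n⟩, map μ x⟩),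
        (hc x).tgt_eq_src⟩
    have hg : IsOpenMap g := by
      intro U hU
      have h1 := isOpenMap_mk (V := V) ⟨i, j, A, l, r⟩ _ ((isOpenEmbedding_map ν).isOpenMap U hU)
      have h2 := isOpenMap_mk (V := V) ⟨j, k, B, m, n⟩ _ ((isOpenEmbedding_map μ).isOpenMap U hU)
      convert (h1.prod h2).preimage continuous_subtype_val using 1
      ext ⟨⟨α, β⟩, hαβ⟩
      constructor
      · rintro ⟨x, hx, e⟩
        cases e
        exact ⟨⟨_, ⟨x, hx, rfl⟩, rfl⟩, ⟨_, ⟨x, hx, rfl⟩, rfl⟩⟩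
      · rintro ⟨⟨_, ⟨x, hx, rfl⟩, e1⟩, ⟨_, ⟨y, hy, rfl⟩, e2⟩⟩
        dsimp only at e1 e2 hαβ
        subst e1 e2
        have e3 : map r (map ν x) = map m (map μ y) := eq_of_heq (Sigma.mk.inj_iff.1 hαβ).2
        rw [← map_comp, ← map_comp, sq] at e3
        cases (isOpenEmbedding_map (μ ≫ m)).injective e3
        exact ⟨x, hx, rfl⟩
    have e0 : g d = ⟨(Quot.mk _ ⟨⟨i, j, A, l, r⟩, a⟩, Quot.mk _ ⟨⟨j, k, B, m, n⟩, b⟩), h⟩ := by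
      subst ha hb; rfl
    rw [← e0, ContinuousAt]
    refine (Filter.map_mono (hg.nhds_le d)).trans ?_
    rw [Filter.map_map]
    have e1 : (fun p : {p : SpanArr V × SpanArr V // p.1.tgt = p.2.src} =>
        SpanArr.comp p.1.1 p.1.2 p.2) ∘ g =
        fun x => (Quot.mk _ ⟨⟨i, k, D, ν ≫ l, μ ≫ n⟩, x⟩ : SpanArr V) :=
      funext fun x => SpanArr.comp_mk (hc x) (hc x).tgt_eq_src
    have e2 := (continuous_mk (V := V) ⟨i, k, D, ν ≫ l, μ ≫ n⟩).tendsto d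
    rw [← e1] at e2
    have e3 : SpanArr.comp (g d).1.1 (g d).1.2 (g d).2 =
        Quot.mk _ ⟨⟨i, k, D, ν ≫ l, μ ≫ n⟩, d⟩ := SpanArr.comp_mk (hc d) _
    change _ ≤ 𝓝 (SpanArr.comp (g d).1.1 (g d).1.2 (g d).2)
    rw [e3]
    exact e2

variable (V) in
/-- The groupoid of a family of charts `V i`, `i ∈ I`, in a category of charts: its objects are the
points of the disjoint union of the charts, its arrows are the classes `[λ₁, a, λ₂]`. -/
noncomputable def spanGroupoid : TopGroupoid where
  Obj := Σ i, Pt.{u} (V i)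
  Arr := SpanArr V
  src := SpanArr.src
  tgt := SpanArr.tgt
  one x := Quot.mk _ (Triple.one x)
  inv := SpanArr.inv
  comp := SpanArr.comp
  src_one x := by
    change Triple.src _ = x
    simp [Triple.src, Triple.one, map_id]
  tgt_one x := by
    change Triple.tgt _ = x
    simp [Triple.tgt, Triple.one, map_id]
  src_inv a := by induction a using Quot.ind; rfl
  tgt_inv a := by induction a using Quot.ind; rfl
  src_comp a b h := by
    obtain ⟨R, S, T, rfl, rfl, hR⟩ := SpanArr.exists_composite a b h
    rw [SpanArr.comp_mk hR]
    exact hR.src_eq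
  tgt_comp a b h := by
    obtain ⟨R, S, T, rfl, rfl, hR⟩ := SpanArr.exists_composite a b h
    rw [SpanArr.comp_mk hR]
    exact hR.tgt_eq
  one_comp a := by
    induction a using Quot.ind with | _ S
    obtain ⟨⟨i, j, A, l, r⟩, a⟩ := S
    have h : Composite (V := V) (Triple.one ⟨i, map l a⟩) ⟨⟨i, j, A, l, r⟩, a⟩
        ⟨⟨i, j, A, l ≫ 𝟙 _, 𝟙 _ ≫ r⟩, a⟩ :=
      Composite.mk _ _ _ _ _ _ _ _ _ _ _ _ _ _ _ rfl (map_id _) (by simp)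
    refine (SpanArr.comp_mk h _).trans ?_
    rw [Category.id_comp, Category.comp_id]
  comp_one a := by
    induction a using Quot.ind with | _ S
    obtain ⟨⟨i, j, A, l, r⟩, a⟩ := S
    have h : Composite (V := V) ⟨⟨i, j, A, l, r⟩, a⟩ (Triple.one ⟨j, map r a⟩)
        ⟨⟨i, j, A, 𝟙 _ ≫ l, r ≫ 𝟙 _⟩, a⟩ :=
      Composite.mk _ _ _ _ _ _ _ _ _ _ _ _ _ _ _ (map_id _) rfl (by simp)
    refine (SpanArr.comp_mk h _).trans ?_
    rw [Category.id_comp, Category.comp_id]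
  assoc a b c h h' := by
    obtain ⟨R, S, T, rfl, rfl, hR⟩ := SpanArr.exists_composite a b h
    induction c using Quot.ind with | _ U
    obtain ⟨Q, hQ⟩ := Composite.exists (S := R) (T := U) (hR.tgt_eq.trans h')
    obtain ⟨P, hP⟩ := Composite.exists (S := T) (T := U) h'
    obtain ⟨Q', hQ'⟩ := Composite.exists (S := S) (T := P) (h.trans hP.src_eq.symm)
    have e1 : ∀ k, SpanArr.comp (SpanArr.comp (Quot.mk _ S) (Quot.mk _ T) h) (Quot.mk _ U) k =
        Quot.mk _ Q := by
      rw [SpanArr.comp_mk hR]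
      exact SpanArr.comp_mk hQ
    have e2 : ∀ k, SpanArr.comp (Quot.mk _ S) (SpanArr.comp (Quot.mk _ T) (Quot.mk _ U) h') k =
        Quot.mk _ Q' := by
      rw [SpanArr.comp_mk hP]
      exact SpanArr.comp_mk hQ'
    rw [e1, e2]
    cases hR with
    | mk i j k A B D l r m n ν μ a b d ha hb sq =>
      generalize hZ : (⟨⟨i, k, D, ν ≫ l, μ ≫ n⟩, d⟩ : Triple V) = Z at hQ
      cases hQ with
      | mk i' k' k₂ D' B₂ E l₂ r₂ p q σ τ d' c e hσ hτ sq' =>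
        cases hZ
        have hP' : Composite (V := V) ⟨⟨j, k, B, m, n⟩, b⟩ ⟨⟨k, k₂, B₂, p, q⟩, c⟩
            ⟨⟨j, k₂, E, (σ ≫ μ) ≫ m, τ ≫ q⟩, e⟩ :=
          Composite.mk _ _ _ _ _ _ _ _ _ _ _ _ _ _ _ (by rw [map_comp, hσ, hb]) hτ
            (by rw [Category.assoc, sq'])
        have hQ₂ : Composite (V := V) ⟨⟨i, j, A, l, r⟩, a⟩
            ⟨⟨j, k₂, E, (σ ≫ μ) ≫ m, τ ≫ q⟩, e⟩
            ⟨⟨i, k₂, E, (σ ≫ ν) ≫ l, 𝟙 _ ≫ τ ≫ q⟩, e⟩ :=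
          Composite.mk _ _ _ _ _ _ _ _ _ _ _ _ _ _ _ (by rw [map_comp, hσ, ha]) (map_id _)
            (by rw [Category.id_comp, Category.assoc, sq, Category.assoc])
        rw [hQ'.well_defined rfl (hP.unique hP') hQ₂, Category.id_comp, Category.assoc]
  comp_inv a := by
    induction a using Quot.ind with | _ S
    obtain ⟨⟨i, j, A, l, r⟩, a⟩ := S
    have h : Composite (V := V) ⟨⟨i, j, A, l, r⟩, a⟩ ⟨⟨j, i, A, r, l⟩, a⟩
        ⟨⟨i, i, A, 𝟙 _ ≫ l, 𝟙 _ ≫ l⟩, a⟩ :=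
      Composite.mk _ _ _ _ _ _ _ _ _ _ _ _ _ _ _ (map_id _) (map_id _) rfl
    refine (SpanArr.comp_mk h _).trans (Quot.sound ?_)
    exact Refines.mk i i (V i) A (𝟙 _) (𝟙 _) l _ _ a _ rfl (by simp) (by simp)
  inv_comp a := by
    induction a using Quot.ind with | _ S
    obtain ⟨⟨i, j, A, l, r⟩, a⟩ := S
    have h : Composite (V := V) ⟨⟨j, i, A, r, l⟩, a⟩ ⟨⟨i, j, A, l, r⟩, a⟩
        ⟨⟨j, j, A, 𝟙 _ ≫ r, 𝟙 _ ≫ r⟩, a⟩ :=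
      Composite.mk _ _ _ _ _ _ _ _ _ _ _ _ _ _ _ (map_id _) (map_id _) rfl
    refine (SpanArr.comp_mk h _).trans (Quot.sound ?_)
    exact Refines.mk j j (V j) A (𝟙 _) (𝟙 _) r _ _ a _ rfl (by simp) (by simp)
  continuous_src := SpanArr.continuous_src
  continuous_tgt := SpanArr.continuous_tgt
  continuous_one := continuous_sigma fun i => continuous_mk ⟨i, i, V i, 𝟙 _, 𝟙 _⟩
  continuous_inv := SpanArr.continuous_inv
  continuous_comp := SpanArr.continuous_comp

end ChartCat

/-! ## Finite groups of diffeomorphisms -/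

section FixedPoints

variable {n : ℕ} {V : Type u} [TopologicalSpace V] [ChartedSpace (EuclideanSpace ℝ (Fin n)) V]
  {G : Type w} [Group G] [Finite G] [MulAction G V]

theorem mem_interior_fixedBy_of_mem_closure [T2Space V]
    (hs : ∀ g : G, ContMDiff (𝓡 n) (𝓡 n) ∞ (fun x : V => g • x)) (g : G) (x : V)
    (hx : x ∈ closure (interior (MulAction.fixedBy V g))) :
    x ∈ interior (MulAction.fixedBy V g) := by
  classical
  have hgx : g • x = x := by
    have hcl : IsClosed (MulAction.fixedBy V g) :=
      isClosed_eq (hs g).continuous continuous_id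
    exact hcl.closure_subset_iff.2 interior_subset hx
  set e := extChartAt (𝓡 n) x with he
  have hfix : ∀ h ∈ Subgroup.zpowers g, ∀ z ∈ MulAction.fixedBy V g, h • z = z := by
    intro h hh z hz
    have : g ∈ MulAction.stabilizer G z := hz
    exact (Subgroup.zpowers_le.2 this) hh
  -- the local representative of an element of the cyclic group has derivative the identity
  have key : ∀ h : Subgroup.zpowers g, HasStrictFDerivAt (fun y => e ((h : G) • e.symm y))
      (ContinuousLinearMap.id ℝ (EuclideanSpace ℝ (Fin n))) (e x) := by
    intro h
    have hhx : (h : G) • x = x := hfix h h.2 x hgx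
    have h1 := ((contMDiffAt_iff.1 ((hs (h : G)) x)).2)
    rw [hhx] at h1
    have h2 : ContDiffAt ℝ ∞ (fun y => e ((h : G) • e.symm y)) (e x) := by
      rw [ModelWithCorners.range_eq_univ, contDiffWithinAt_univ] at h1
      exact h1
    have h3 := h2.hasStrictFDerivAt (by simp)
    suffices h4 : fderiv ℝ (fun y => e ((h : G) • e.symm y)) (e x) =
        ContinuousLinearMap.id ℝ (EuclideanSpace ℝ (Fin n)) by rwa [h4] at h3
    have hcont : ContinuousAt (fderiv ℝ (fun y => e ((h : G) • e.symm y))) (e x) :=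
      (h2.fderiv_right (m := 0) (by simp)).continuousAt
    have hcont' : ContinuousAt (fun z => fderiv ℝ (fun y => e ((h : G) • e.symm y)) (e z)) x :=
      ContinuousAt.comp (g := fderiv ℝ (fun y => e ((h : G) • e.symm y))) hcont
        (continuousAt_extChartAt x)
    have hev : ∃ᶠ z in 𝓝 x, fderiv ℝ (fun y => e ((h : G) • e.symm y)) (e z) =
        ContinuousLinearMap.id ℝ (EuclideanSpace ℝ (Fin n)) := by
      have hfr := mem_closure_iff_frequently.1 hx
      refine (hfr.and_eventually (extChartAt_source_mem_nhds (I := 𝓡 n) x)).mono ?_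
      rintro z ⟨hz, hzs⟩
      have hzt : e z ∈ e.target := e.map_source hzs
      have hopen : e.target ∈ 𝓝 (e z) := (isOpen_extChartAt_target x).mem_nhds hzt
      have hc : ContinuousAt e.symm (e z) :=
        (continuousOn_extChartAt_symm x).continuousAt hopen
      have hmem : ∀ᶠ y in 𝓝 (e z), e.symm y ∈ interior (MulAction.fixedBy V g) :=
        hc.eventually (by rw [e.left_inv hzs]; exact isOpen_interior.mem_nhds hz)
      have heq : (fun y => e ((h : G) • e.symm y)) =ᶠ[𝓝 (e z)] id := by
        filter_upwards [hmem, hopen] with y hy hyt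
        rw [hfix h h.2 _ (interior_subset hy), e.right_inv hyt, id]
      rw [heq.fderiv_eq, fderiv_id]
    have hclosed : IsClosed {L : EuclideanSpace ℝ (Fin n) →L[ℝ] EuclideanSpace ℝ (Fin n) |
      L = ContinuousLinearMap.id ℝ (EuclideanSpace ℝ (Fin n))} := isClosed_singleton
    exact hclosed.mem_of_frequently_of_tendsto hev hcont'
  have : Fintype (Subgroup.zpowers g) := Fintype.ofFinite _
  let s : V → EuclideanSpace ℝ (Fin n) := fun z =>
    (Fintype.card (Subgroup.zpowers g) : ℝ)⁻¹ • ∑ h : Subgroup.zpowers g, e ((h : G) • z)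
  have hsinv : ∀ z, s (g • z) = s z := by
    intro z
    simp only [s]
    congr 1
    have h := Equiv.sum_comp
      (Equiv.mulRight (⟨g, Subgroup.mem_zpowers g⟩ : Subgroup.zpowers g))
      (fun h : Subgroup.zpowers g => e ((h : G) • z))
    simpa [mul_smul] using h
  have hder : HasStrictFDerivAt (fun y => s (e.symm y))
      ((ContinuousLinearEquiv.refl ℝ (EuclideanSpace ℝ (Fin n)) :
        EuclideanSpace ℝ (Fin n) →L[ℝ] EuclideanSpace ℝ (Fin n))) (e x) := by
    have h1 := (HasStrictFDerivAt.fun_sum (u := Finset.univ) fun h _ => key h).const_smul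
      ((Fintype.card (Subgroup.zpowers g) : ℝ)⁻¹)
    have hc : (Fintype.card (Subgroup.zpowers g) : ℝ) ≠ 0 :=
      Nat.cast_ne_zero.2 Fintype.card_ne_zero
    have hL : (Fintype.card (Subgroup.zpowers g) : ℝ)⁻¹ • ∑ _h : Subgroup.zpowers g,
        ContinuousLinearMap.id ℝ (EuclideanSpace ℝ (Fin n)) =
        (ContinuousLinearEquiv.refl ℝ (EuclideanSpace ℝ (Fin n)) :
          EuclideanSpace ℝ (Fin n) →L[ℝ] EuclideanSpace ℝ (Fin n)) := by
      rw [Finset.sum_const, Finset.card_univ, ← Nat.cast_smul_eq_nsmul ℝ, smul_smul,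
        inv_mul_cancel₀ hc, one_smul]
      rfl
    rw [hL] at h1
    exact h1
  have hinj := hder.eventually_left_inverse
  set li := hder.localInverse _ _ _ with hli
  have hinj' : ∀ᶠ z in 𝓝 x, li (s z) = e z := by
    have h1 := (continuousAt_extChartAt (I := 𝓡 n) x).eventually hinj
    filter_upwards [h1, extChartAt_source_mem_nhds (I := 𝓡 n) x] with z hz hzs
    rwa [← he, e.left_inv hzs] at hz
  have hgc : Filter.Tendsto (fun z : V => g • z) (𝓝 x) (𝓝 x) := by
    have := (hs g).continuous.tendsto x
    rwa [hgx] at this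
  rw [mem_interior_iff_mem_nhds]
  filter_upwards [hinj', hgc.eventually hinj', extChartAt_source_mem_nhds (I := 𝓡 n) x,
    hgc.eventually (extChartAt_source_mem_nhds (I := 𝓡 n) x)] with z h1 h2 h3 h4
  rw [hsinv, h1] at h2
  exact (e.injOn h3 h4 h2).symm

/-- In a faithful smooth action of a finite group on a connected manifold, the fixed point sets
of non-trivial elements have empty interior. -/
theorem interior_fixedBy_eq_empty [T2Space V] [ConnectedSpace V] [FaithfulSMul G V]
    (hs : ∀ g : G, ContMDiff (𝓡 n) (𝓡 n) ∞ (fun x : V => g • x)) {g : G} (hg : g ≠ 1) :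
    interior (MulAction.fixedBy V g) = ∅ := by
  have hclopen : IsClopen (interior (MulAction.fixedBy V g)) :=
    ⟨isClosed_of_closure_subset fun x hx => mem_interior_fixedBy_of_mem_closure hs g x hx,
      isOpen_interior⟩
  rcases isClopen_iff.1 hclopen with h | h
  · exact h
  · refine absurd (eq_of_smul_eq_smul (α := V) fun x => ?_) hg
    have : x ∈ MulAction.fixedBy V g := interior_subset (h ▸ Set.mem_univ x)
    rw [one_smul]
    exact this

end FixedPoints

/-! ## Orbifold charts and their embeddings -/

/-- An `n`-dimensional orbifold chart (uniformizing system) of `X`: a connected smooth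
`n`-manifold `V` with a smooth effective action of a finite group `G` and a continuous map
`π : V → X` inducing a homeomorphism of `V / G` onto an open subset of `X`. -/
structure OrbifoldChart (n : ℕ) (X : Type v) [TopologicalSpace X] where
  V : Type u
  G : Type u
  [topologicalSpace : TopologicalSpace V]
  [chartedSpace : ChartedSpace (EuclideanSpace ℝ (Fin n)) V]
  [isManifold : IsManifold (𝓡 n) ∞ V]
  [t2Space : T2Space V]
  [secondCountable : SecondCountableTopology V]
  [connectedSpace : ConnectedSpace V]
  [group : Group G]
  [finite : Finite G]
  [mulAction : MulAction G V]
  [faithful : FaithfulSMul G V]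
  smooth : ∀ g : G, ContMDiff (𝓡 n) (𝓡 n) ∞ (fun x : V => g • x)
  π : V → X
  continuous_π : Continuous π
  isOpenMap_π : IsOpenMap π
  π_eq_iff : ∀ x y : V, π x = π y ↔ ∃ g : G, g • x = y

attribute [instance] OrbifoldChart.topologicalSpace OrbifoldChart.chartedSpace
  OrbifoldChart.isManifold OrbifoldChart.t2Space OrbifoldChart.secondCountable
  OrbifoldChart.connectedSpace OrbifoldChart.group OrbifoldChart.finite OrbifoldChart.mulAction
  OrbifoldChart.faithful

namespace OrbifoldChart

variable {n : ℕ} {X : Type v} [TopologicalSpace X]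

/-- An embedding `(λ, φ)` of orbifold charts: a smooth open embedding `λ` over `X` that is
equivariant along a monomorphism `φ`. -/
@[ext]
structure Embedding (A B : OrbifoldChart.{u, v} n X) where
  toFun : A.V → B.V
  hom : A.G →* B.G
  hom_injective : Function.Injective hom
  injective : Function.Injective toFun
  isLocalDiffeomorph : IsLocalDiffeomorph (𝓡 n) (𝓡 n) ∞ toFun
  equivariant : ∀ (g : A.G) (x : A.V), toFun (g • x) = hom g • toFun x
  π_comp : ∀ x, B.π (toFun x) = A.π x

theorem smul_localDiffeo (A : OrbifoldChart.{u, v} n X) (g : A.G) :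
    IsLocalDiffeomorph (𝓡 n) (𝓡 n) ∞ (fun x : A.V => g • x) :=
  Diffeomorph.isLocalDiffeomorph
    { toFun := fun x => g • x
      invFun := fun x => g⁻¹ • x
      left_inv := fun x => inv_smul_smul g x
      right_inv := fun x => smul_inv_smul g x
      contMDiff_toFun := A.smooth g
      contMDiff_invFun := A.smooth g⁻¹ }

instance : Category (OrbifoldChart.{u, v} n X) where
  Hom := Embedding
  id A :=
    { toFun := id
      hom := MonoidHom.id _
      hom_injective := Function.injective_id
      injective := Function.injective_id
      isLocalDiffeomorph := (Diffeomorph.refl (𝓡 n) A.V ∞).isLocalDiffeomorph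
      equivariant := fun _ _ => rfl
      π_comp := fun _ => rfl }
  comp f g :=
    { toFun := g.toFun ∘ f.toFun
      hom := g.hom.comp f.hom
      hom_injective := g.hom_injective.comp f.hom_injective
      injective := g.injective.comp f.injective
      isLocalDiffeomorph := fun x => (f.isLocalDiffeomorph x).comp (𝓡 n) _ (g.isLocalDiffeomorph _)
      equivariant := fun h x => by simp [f.equivariant, g.equivariant]
      π_comp := fun x => (g.π_comp _).trans (f.π_comp x) }

theorem Embedding.isOpenEmbedding {A B : OrbifoldChart.{u, v} n X} (f : A ⟶ B) :
    IsOpenEmbedding f.toFun :=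
  f.isLocalDiffeomorph.isLocalHomeomorph.isOpenEmbedding_of_injective f.injective

/-- The embedding `(λ_g, φ_g)` of a chart into itself, `λ_g(x) = g x`, `φ_g(a) = g a g⁻¹`. -/
def translate (A : OrbifoldChart.{u, v} n X) (g : A.G) : A ⟶ A where
  toFun x := g • x
  hom := (MulAut.conj g).toMonoidHom
  hom_injective := (MulAut.conj g).injective
  injective := MulAction.injective g
  isLocalDiffeomorph := A.smul_localDiffeo g
  equivariant h x := by simp [mul_smul]
  π_comp x := ((A.π_eq_iff _ _).2 ⟨g, rfl⟩).symm

/-- A group element moving a point of the image of an embedding to a point of the image comes from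
the source. -/
theorem Embedding.exists_hom_eq {A B : OrbifoldChart.{u, v} n X} (f : A ⟶ B) (c : B.G)
    (a a' : A.V) (h : c • f.toFun a = f.toFun a') : ∃ k, f.hom k = c := by
  by_contra! hne
  have hO : IsOpen (f.toFun ⁻¹' ((fun x => c • x) ⁻¹' Set.range f.toFun)) :=
    ((f.isOpenEmbedding.isOpen_range.preimage (B.smooth c).continuous).preimage
      f.isOpenEmbedding.continuous)
  have hO' := f.isOpenEmbedding.isOpenMap _ hO
  have hd : Dense (⋂ k : A.G, (MulAction.fixedBy B.V ((f.hom k)⁻¹ * c))ᶜ) := by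
    have : BaireSpace B.V := by
      have : LocallyCompactSpace B.V :=
        Manifold.locallyCompact_of_finiteDimensional (𝓡 n)
      infer_instance
    refine dense_iInter_of_isOpen (fun k => ?_) (fun k => ?_)
    · exact (isClosed_eq (B.smooth _).continuous continuous_id).isOpen_compl
    · rw [← interior_eq_empty_iff_dense_compl]
      refine interior_fixedBy_eq_empty B.smooth fun h1 => hne k ?_
      exact (inv_mul_eq_one.1 h1)
  obtain ⟨y, ⟨x, ⟨x', hx'⟩, rfl⟩, hy⟩ := hd.inter_open_nonempty _ hO' ⟨_, a, ⟨a', h.symm⟩, rfl⟩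
  have e : A.π x = A.π x' := by
    rw [← f.π_comp x', ← f.π_comp x, hx']
    exact (B.π_eq_iff _ _).2 ⟨c, rfl⟩
  obtain ⟨k, rfl⟩ := (A.π_eq_iff _ _).1 e
  refine (Set.mem_iInter.1 hy k) ?_
  change ((f.hom k)⁻¹ * c) • f.toFun x = f.toFun x
  change f.toFun (k • x) = c • f.toFun x at hx'
  rw [mul_smul, ← hx', f.equivariant, inv_smul_smul]

/-- Small neighbourhoods of a point that are stable under the isotropy group of that point. -/
theorem exists_stable_nhd (A : OrbifoldChart.{u, v} n X) (a : A.V) (N : Set A.V) (hN : IsOpen N)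
    (ha : a ∈ N) : ∃ Y : Set A.V, IsOpen Y ∧ IsConnected Y ∧ a ∈ Y ∧ Y ⊆ N ∧
      (∀ g : A.G, g • a = a → ∀ y ∈ Y, g • y ∈ Y) ∧
      (∀ g : A.G, ∀ y ∈ Y, g • y ∈ Y → g • a = a) := by
  have hcont : ∀ g : A.G, Continuous fun x : A.V => g • x := fun g => (A.smooth g).continuous
  have hlc : LocallyConnectedSpace A.V :=
    ChartedSpace.locallyConnectedSpace (EuclideanSpace ℝ (Fin n)) A.V
  have h0 : ∀ g : A.G, ∃ U : Set A.V, IsOpen U ∧ a ∈ U ∧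
      (g • a ≠ a → ∀ y ∈ U, g • y ∉ U) := by
    intro g
    by_cases hg : g • a = a
    · exact ⟨Set.univ, isOpen_univ, trivial, fun h => absurd hg h⟩
    · obtain ⟨U, U', hU, hU', h1, h2, hd⟩ := t2_separation hg
      exact ⟨U' ∩ (fun x => g • x) ⁻¹' U, hU'.inter (hU.preimage (hcont g)), ⟨h2, h1⟩,
        fun _ y hy hy' => Set.disjoint_left.1 hd hy.2 hy'.1⟩
  choose U hU haU hsep using h0
  let N₁ : Set A.V := N ∩ ⋂ g : A.G, U g
  have hN₁ : IsOpen N₁ := hN.inter (isOpen_iInter_of_finite hU)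
  have haN₁ : a ∈ N₁ := ⟨ha, Set.mem_iInter.2 haU⟩
  let N₂ : Set A.V := ⋂ g : MulAction.stabilizer A.G a, (fun x => (g : A.G) • x) ⁻¹' N₁
  have hN₂ : IsOpen N₂ := isOpen_iInter_of_finite fun g => hN₁.preimage (hcont g)
  have haN₂ : a ∈ N₂ := Set.mem_iInter.2 fun g => by
    change (g : A.G) • a ∈ N₁
    rw [show (g : A.G) • a = a from g.2]
    exact haN₁
  have hN₂₁ : N₂ ⊆ N₁ := fun y hy => by simpa using Set.mem_iInter.1 hy 1
  have hst : ∀ g : A.G, g • a = a → ∀ y ∈ N₂, g • y ∈ N₂ := by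
    intro g hg y hy
    refine Set.mem_iInter.2 fun h => ?_
    have := Set.mem_iInter.1 hy (h * ⟨g, hg⟩)
    simpa [mul_smul] using this
  refine ⟨connectedComponentIn N₂ a, hN₂.connectedComponentIn,
    isConnected_connectedComponentIn_iff.2 haN₂, mem_connectedComponentIn haN₂,
    (connectedComponentIn_subset _ _).trans (hN₂₁.trans Set.inter_subset_left), ?_, ?_⟩
  · intro g hg y hy
    have h1 : _root_.IsPreconnected ((fun x => g • x) '' connectedComponentIn N₂ a) :=
      isPreconnected_connectedComponentIn.image _ (hcont g).continuousOn
    refine h1.subset_connectedComponentIn ⟨a, mem_connectedComponentIn haN₂, hg⟩ ?_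
      ⟨y, hy, rfl⟩
    rintro _ ⟨z, hz, rfl⟩
    exact hst g hg z (connectedComponentIn_subset _ _ hz)
  · intro g y hy hgy
    by_contra hg
    have h1 := Set.mem_iInter.1 (hN₂₁ (connectedComponentIn_subset _ _ hy)).2 g
    have h2 := Set.mem_iInter.1 (hN₂₁ (connectedComponentIn_subset _ _ hgy)).2 g
    exact hsep g hg y h1 h2

/-- Data of a connected open set stable under a subgroup and moved off itself by all other
elements. -/
structure StableSet (A : OrbifoldChart.{u, v} n X) where
  Y : TopologicalSpace.Opens A.V
  H : Subgroup A.G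
  conn : IsConnected (Y : Set A.V)
  stable : ∀ g ∈ H, ∀ y ∈ Y, g • y ∈ Y
  mem : ∀ g : A.G, ∀ y ∈ Y, g • y ∈ Y → g ∈ H

/-- The restriction of a chart to a stable open set. -/
noncomputable def restrict (A : OrbifoldChart.{u, v} n X) (S : A.StableSet) :
    OrbifoldChart.{u, v} n X :=
  letI act : MulAction S.H S.Y :=
    { smul := fun g y => ⟨(g : A.G) • (y : A.V), S.stable g g.2 y y.2⟩
      one_smul := fun y => Subtype.ext (one_smul A.G (y : A.V))
      mul_smul := fun g h y => Subtype.ext (mul_smul (g : A.G) (h : A.G) (y : A.V)) }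
  haveI : ConnectedSpace S.Y := Subtype.connectedSpace S.conn
  haveI : FaithfulSMul S.H S.Y := ⟨fun {g h} hgh => by
    by_contra hne
    have h1 : (h : A.G)⁻¹ * g ≠ 1 := fun e => hne (Subtype.ext (inv_mul_eq_one.1 e).symm)
    have h2 := interior_fixedBy_eq_empty A.smooth h1
    obtain ⟨y, hy⟩ := S.conn.nonempty
    have h3 : (S.Y : Set A.V) ⊆ interior (MulAction.fixedBy A.V ((h : A.G)⁻¹ * g)) := by
      refine interior_maximal (fun z hz => ?_) S.Y.isOpen
      have := congrArg Subtype.val (hgh ⟨z, hz⟩)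
      change (g : A.G) • z = (h : A.G) • z at this
      change ((h : A.G)⁻¹ * g) • z = z
      rw [mul_smul, this, inv_smul_smul]
    rw [h2] at h3
    exact h3 hy⟩
  { V := S.Y
    G := S.H
    smooth := fun g => by
      rw [← ContMDiff.subtypeVal_comp_iff]
      exact (A.smooth g).comp contMDiff_subtype_val
    π := fun y => A.π y
    continuous_π := A.continuous_π.comp continuous_subtype_val
    isOpenMap_π := A.isOpenMap_π.comp S.Y.isOpen.isOpenMap_subtype_val
    π_eq_iff := fun x y => by
      rw [A.π_eq_iff]
      constructor
      · rintro ⟨g, hg⟩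
        exact ⟨⟨g, S.mem g x x.2 (by rw [hg]; exact y.2)⟩, Subtype.ext hg⟩
      · rintro ⟨g, hg⟩
        exact ⟨g, congrArg Subtype.val hg⟩ }

theorem isLocalDiffeomorph_val (A : OrbifoldChart.{u, v} n X) (Y : TopologicalSpace.Opens A.V) :
    IsLocalDiffeomorph (𝓡 n) (𝓡 n) ∞ (Subtype.val : Y → A.V) := by
  intro y
  have : Nonempty Y := ⟨y⟩
  refine ⟨{ toPartialEquiv := (Y.openPartialHomeomorphSubtypeCoe ⟨y⟩).toPartialEquiv
            open_source := (Y.openPartialHomeomorphSubtypeCoe ⟨y⟩).open_source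
            open_target := (Y.openPartialHomeomorphSubtypeCoe ⟨y⟩).open_target
            contMDiffOn_toFun := contMDiff_subtype_val.contMDiffOn
            contMDiffOn_invFun := ?_ }, trivial, fun _ _ => rfl⟩
  intro z hz
  rw [← ContMDiffWithinAt.subtypeVal_comp_iff]
  refine contMDiffWithinAt_id.congr (fun w hw => ?_) ?_
  · exact (Y.openPartialHomeomorphSubtypeCoe ⟨y⟩).right_inv hw
  · exact (Y.openPartialHomeomorphSubtypeCoe ⟨y⟩).right_inv hz

theorem isLocalDiffeomorph_of_comp {V₁ V₂ V₃ : Type u} [TopologicalSpace V₁]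
    [ChartedSpace (EuclideanSpace ℝ (Fin n)) V₁] [TopologicalSpace V₂]
    [ChartedSpace (EuclideanSpace ℝ (Fin n)) V₂] [TopologicalSpace V₃]
    [ChartedSpace (EuclideanSpace ℝ (Fin n)) V₃] {f : V₁ → V₃} {g : V₂ → V₃} {k : V₁ → V₂}
    (hf : IsLocalDiffeomorph (𝓡 n) (𝓡 n) ∞ f) (hg : IsLocalDiffeomorph (𝓡 n) (𝓡 n) ∞ g)
    (hinj : Function.Injective g) (h : ∀ x, g (k x) = f x) :
    IsLocalDiffeomorph (𝓡 n) (𝓡 n) ∞ k := by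
  intro x
  obtain ⟨Φ, hx, hΦ⟩ := hf x
  obtain ⟨Ψ, hy, hΨ⟩ := hg (k x)
  refine ⟨Φ.trans Ψ.symm, ⟨hx, ?_⟩, ?_⟩
  · change Φ x ∈ Ψ.target
    rw [← hΦ hx, ← h, hΨ hy]
    exact Ψ.map_source hy
  · rintro z ⟨hz, hz'⟩
    change Φ z ∈ Ψ.target at hz'
    change k z = Ψ.invFun (Φ z)
    apply hinj
    refine ((h z).trans (hΦ hz)).trans ?_
    exact ((hΨ (Ψ.map_target hz')).trans (Ψ.right_inv hz')).symm

/-- The inclusion of a restricted chart. -/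
noncomputable def restrictIncl (A : OrbifoldChart.{u, v} n X) (S : A.StableSet) :
    A.restrict S ⟶ A where
  toFun := Subtype.val
  hom := S.H.subtype
  hom_injective := S.H.subtype_injective
  injective := Subtype.val_injective
  isLocalDiffeomorph := A.isLocalDiffeomorph_val S.Y
  equivariant _ _ := rfl
  π_comp _ := rfl

/-- Embeddings with the same target are factored through each other. -/
theorem exists_lift {A B D : OrbifoldChart.{u, v} n X} (f : A ⟶ D) (g : B ⟶ D)
    (hr : ∀ a, f.toFun a ∈ Set.range g.toFun) : ∃ k : A ⟶ B, k ≫ g = f := by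
  choose k hk using hr
  have hG : ∀ h : A.G, ∃ c, g.hom c = f.hom h := fun h => by
    obtain ⟨a⟩ : Nonempty A.V := inferInstance
    exact g.exists_hom_eq (f.hom h) (k a) (k (h • a)) (by rw [hk, hk, f.equivariant])
  choose φ hφ using hG
  let e : A ⟶ B :=
    { toFun := k
      hom :=
        { toFun := φ
          map_one' := g.hom_injective (by rw [hφ, map_one, map_one])
          map_mul' := fun x y => g.hom_injective (by rw [hφ, map_mul, map_mul, hφ, hφ]) }
      hom_injective := fun x y hxy => f.hom_injective (by
        rw [← hφ, ← hφ]; exact congrArg g.hom hxy)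
      injective := fun x y hxy => f.injective (by rw [← hk, ← hk, hxy])
      isLocalDiffeomorph := isLocalDiffeomorph_of_comp f.isLocalDiffeomorph g.isLocalDiffeomorph
        g.injective hk
      equivariant := fun h x => g.injective (by
        rw [hk, f.equivariant, g.equivariant, hk]
        exact congrArg (· • f.toFun x) (hφ h).symm)
      π_comp := fun x => by rw [← g.π_comp, hk, f.π_comp] }
  refine ⟨e, Embedding.ext (funext hk) (MonoidHom.ext hφ)⟩

instance : ChartCat.{u} (OrbifoldChart.{u, v} n X) where
  Pt A := A.V
  top A := A.topologicalSpace
  map f := f.toFun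
  map_id _ := rfl
  map_comp _ _ _ := rfl
  isOpenEmbedding_map f := f.isOpenEmbedding
  mono f := ⟨fun g h e => Embedding.ext
    (funext fun x => f.injective (congrFun (congrArg Embedding.toFun e) x))
    (MonoidHom.ext fun x => f.hom_injective (DFunLike.congr_fun (congrArg Embedding.hom e) x))⟩
  refine {A B D} f g a b hab := by
    obtain ⟨Y, hY, hc, haY, hYN, h1, h2⟩ := A.exists_stable_nhd a (f.toFun ⁻¹' Set.range g.toFun)
      (g.isOpenEmbedding.isOpen_range.preimage f.isOpenEmbedding.continuous) ⟨b, hab.symm⟩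
    let S : A.StableSet := ⟨⟨Y, hY⟩, MulAction.stabilizer A.G a, hc, h1, h2⟩
    obtain ⟨k, hk⟩ := exists_lift (A.restrictIncl S ≫ f) g (fun y => hYN y.2)
    refine ⟨A.restrict S, ⟨a, haY⟩, A.restrictIncl S, k, rfl, ?_, hk.symm⟩
    apply g.injective
    rw [← hab]
    exact congrFun (congrArg Embedding.toFun hk) ⟨a, haY⟩

end OrbifoldChart

/-! ## Orbifolds and their groupoids -/

/-- An `n`-dimensional orbifold structure `{(V_p, G_p, π_p)}_{p ∈ X}` on `X`: every point `p` has
a chart of a neighbourhood of `p`, and for every point `q` in the image of the chart at `p` the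
charts at `p` and at `q` induce a common chart at `q`. -/
structure Orbifold (n : ℕ) (X : Type v) [TopologicalSpace X] where
  chart : X → OrbifoldChart.{u, v} n X
  mem_range : ∀ p, p ∈ Set.range (chart p).π
  compatible : ∀ p q, q ∈ Set.range (chart p).π → ∃ W : OrbifoldChart.{u, v} n X,
    q ∈ Set.range W.π ∧ Nonempty (W ⟶ chart p) ∧ Nonempty (W ⟶ chart q)

/-- A chart together with an element `k` of its group. -/
structure MarkedChart (n : ℕ) (X : Type v) [TopologicalSpace X] where
  chart : OrbifoldChart.{u, v} n X
  mark : chart.G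

namespace MarkedChart

variable {n : ℕ} {X : Type v} [TopologicalSpace X]

/-- An embedding of marked charts: an embedding `(λ, φ)` of charts such that `φ` respects the
marked elements. -/
@[ext]
structure Hom (A B : MarkedChart.{u, v} n X) where
  emb : A.chart ⟶ B.chart
  hom_mark : emb.hom A.mark = B.mark

instance : Category (MarkedChart.{u, v} n X) where
  Hom := Hom
  id A := ⟨𝟙 A.chart, rfl⟩
  comp f g := ⟨f.emb ≫ g.emb, (congrArg g.emb.hom f.hom_mark).trans g.hom_mark⟩

/-- The sector `V^k` of a marked chart `(V, G, k)`. -/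
abbrev Sector (A : MarkedChart.{u, v} n X) : Type u := {x : A.chart.V // A.mark • x = x}

theorem smul_iff {A B : MarkedChart.{u, v} n X} (f : A ⟶ B) (a : A.chart.V) :
    B.mark • f.emb.toFun a = f.emb.toFun a ↔ A.mark • a = a := by
  rw [← f.hom_mark, ← f.emb.equivariant]
  exact f.emb.injective.eq_iff

/-- The restriction `V^k → V'^{k'}` of an embedding of marked charts. -/
def sectorMap {A B : MarkedChart.{u, v} n X} (f : A ⟶ B) (x : A.Sector) : B.Sector :=
  ⟨f.emb.toFun x.1, (smul_iff f x.1).2 x.2⟩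

theorem isOpenEmbedding_sectorMap {A B : MarkedChart.{u, v} n X} (f : A ⟶ B) :
    IsOpenEmbedding (sectorMap f) := by
  have h := f.emb.isOpenEmbedding
  refine ⟨(h.isEmbedding.comp IsEmbedding.subtypeVal).codRestrict {y | B.mark • y = y}
    (fun x => (sectorMap f x).2), ?_⟩
  convert h.isOpen_range.preimage continuous_subtype_val using 1
  ext ⟨y, hy⟩
  constructor
  · rintro ⟨x, hx⟩
    exact ⟨x.1, congrArg Subtype.val hx⟩
  · rintro ⟨x, rfl⟩
    exact ⟨⟨x, (smul_iff f x).1 hy⟩, rfl⟩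

/-- Marked charts as a category of charts; the points of `(V, G, k)` are those of `V^k`. -/
instance : ChartCat.{u} (MarkedChart.{u, v} n X) where
  Pt A := A.Sector
  top A := instTopologicalSpaceSubtype
  map f := sectorMap f
  map_id _ := rfl
  map_comp _ _ _ := rfl
  isOpenEmbedding_map f := isOpenEmbedding_sectorMap f
  mono f := ⟨fun g h e => Hom.ext (by
    have := ChartCat.mono f.emb
    exact (cancel_mono f.emb).1 (congrArg Hom.emb e))⟩
  refine {A B D} f g a b hab := by
    obtain ⟨R, r, f', g', hf', hg', sq⟩ := ChartCat.refine f.emb g.emb a.1 b.1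
      (congrArg Subtype.val hab)
    change R.V at r
    change f'.toFun r = a.1 at hf'
    obtain ⟨k, hk⟩ := f'.exists_hom_eq A.mark r r (by rw [hf', a.2])
    have hk' : g'.hom k = B.mark := by
      apply g.emb.hom_injective
      rw [g.hom_mark, ← f.hom_mark, ← hk]
      exact (DFunLike.congr_fun (congrArg OrbifoldChart.Embedding.hom sq) k).symm
    have hr : k • r = r := by
      apply f'.injective
      rw [f'.equivariant, hk, hf', a.2]
    exact ⟨⟨R, k⟩, ⟨r, hr⟩, ⟨f', hk⟩, ⟨g', hk'⟩, Subtype.ext hf', Subtype.ext hg',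
      Hom.ext sq⟩

end MarkedChart

namespace Orbifold

variable {n : ℕ} {X : Type v} [TopologicalSpace X] (O : Orbifold.{u, v} n X)

/-- The groupoid associated with an orbifold: objects `⊔ₚ V_p`, arrows the classes
`[λ₁, w, λ₂]` with `λ₁ : W → V_p`, `λ₂ : W → V_q` embeddings of an arbitrary chart `W`. -/
noncomputable def groupoid : TopGroupoid := ChartCat.spanGroupoid O.chart

/-- A choice of one representative in every conjugacy class `(g) ⊂ G_p`, for every `p`. -/
structure Representatives where
  rep : ∀ p, ConjClasses (O.chart p).G → (O.chart p).G
  mk_rep : ∀ p c, ConjClasses.mk (rep p c) = c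

variable {O} (R : O.Representatives)

/-- The chart `(V_p, G_p)` marked with the representative `g` of a class `(g) ⊂ G_p`. -/
def Representatives.marked (i : Σ p, ConjClasses (O.chart p).G) : MarkedChart.{u, v} n X :=
  ⟨O.chart i.1, R.rep i.1 i.2⟩

/-- The groupoid of twisted sectors `Σ̃₁X`: its objects are `⊔ₚ ⊔_{(g) ⊂ G_p} V_p^g × {g}`, its
arrows from `V_p^g` to `V_q^h` are the classes `[λ₁, w, λ₂]` of embeddings
`(λ₁, φ₁) : (W, H) → (V_p, G_p)` and `(λ₂, φ₂) : (W, H) → (V_q, G_q)` with `φ₁(k) = g` and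
`φ₂(k) = h` for a `k ∈ H`, and of points `w ∈ W^k`. -/
noncomputable def twistedSectors : TopGroupoid := ChartCat.spanGroupoid R.marked

variable (O) in
/-- The loop `[id, x, λ_g]` at a point `x ∈ V_p^g`. -/
noncomputable def fixedLoop (p : X) (g : (O.chart p).G) (x : (O.chart p).V) (hx : g • x = x) :
    O.groupoid.Loop :=
  ⟨Quot.mk _ ⟨⟨p, p, O.chart p, 𝟙 _, (O.chart p).translate g⟩, x⟩, by
    change (⟨p, x⟩ : Σ p, (O.chart p).V) = ⟨p, g • x⟩
    rw [hx]⟩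

/-- The triple `(λ₁, w, λ₂)` of charts underlying a triple of marked charts. -/
def forgetMark (T : ChartCat.Triple R.marked) : ChartCat.Triple O.chart :=
  ⟨⟨T.1.i.1, T.1.j.1, T.1.apex.chart, T.1.left.emb, T.1.right.emb⟩, T.2.1⟩

/-- An element `z` of the centralizer of the mark `k` acts on the marked chart `(V, G, k)`. -/
def _root_.MarkedChart.translate (A : MarkedChart.{u, v} n X) (z : Subgroup.centralizer {A.mark}) :
    A ⟶ A :=
  ⟨A.chart.translate z, mul_inv_eq_of_eq_mul (Subgroup.mem_centralizer_singleton_iff.1 z.2)⟩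

/-- The arrow `[id, x, λ_z] : x ⟶ z x` of `Σ̃₁X`, for `x ∈ V_p^g` and `z ∈ C(g)`, where `g` is the
representative of the class `(g) ⊂ G_p`; the domain is the disjoint union `⊔_{(g)} V_p^g × C(g)`. -/
noncomputable def sectorArrow (p : X)
    (a : Σ j : (Σ c : ConjClasses (O.chart p).G, Subgroup.centralizer {(R.marked ⟨p, c⟩).mark}),
      (R.marked ⟨p, j.1⟩).Sector) : (twistedSectors R).Arr :=
  Quot.mk _ ⟨⟨⟨p, a.1.1⟩, ⟨p, a.1.1⟩, R.marked ⟨p, a.1.1⟩, 𝟙 _,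
    (R.marked ⟨p, a.1.1⟩).translate a.1.2⟩, a.2⟩

/-- The arrows `[id, x, λ_z]` compose as in the action groupoid of `C(g)` on `V_p^g`. -/
theorem sectorArrow_comp (p : X) (c : ConjClasses (O.chart p).G)
    (z z' : Subgroup.centralizer {(R.marked ⟨p, c⟩).mark}) (x : (R.marked ⟨p, c⟩).Sector) :
    (twistedSectors R).comp (sectorArrow R p ⟨⟨c, z⟩, x⟩)
      (sectorArrow R p ⟨⟨c, z'⟩, MarkedChart.sectorMap ((R.marked ⟨p, c⟩).translate z) x⟩) rfl =
    sectorArrow R p ⟨⟨c, z' * z⟩, x⟩ := by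
  let A := R.marked ⟨p, c⟩
  have hC : ChartCat.Composite (V := R.marked)
      ⟨⟨⟨p, c⟩, ⟨p, c⟩, A, 𝟙 A, A.translate z⟩, x⟩
      ⟨⟨⟨p, c⟩, ⟨p, c⟩, A, 𝟙 A, A.translate z'⟩, MarkedChart.sectorMap (A.translate z) x⟩
      ⟨⟨⟨p, c⟩, ⟨p, c⟩, A, 𝟙 A ≫ 𝟙 A, A.translate z ≫ A.translate z'⟩, x⟩ :=
    ChartCat.Composite.mk _ _ _ _ _ _ _ _ _ _ (𝟙 A) (A.translate z) _ _ x rfl rfl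
      ((Category.id_comp _).trans (Category.comp_id _).symm)
  have h : A.translate z ≫ A.translate z' = A.translate (z' * z) :=
    MarkedChart.Hom.ext (OrbifoldChart.Embedding.ext
      (funext fun y => (mul_smul z'.1 z.1 y).symm)
      (MonoidHom.ext fun y => (DFunLike.congr_fun
        (map_mul MulAut.conj z'.1 z.1) y).symm))
  rw [h, Category.id_comp] at hC
  exact ChartCat.SpanArr.comp_mk hC rfl

end Orbifold

/-! Everything rests on one fact about effective charts: two embeddings `l`, `r` of a chart `W` into
the same chart satisfy `r = λ_g l` for a unique group element `g`
(`Embedding.exists_comp_translate`, `Embedding.translate_injective`). Since `l` and `r` lie over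
`X`, the closed sets `{g l = r}`, finitely many, cover `W`, and by Baire so do the closures of their
interiors. These closures are disjoint for different `g`: at a common point the derivatives of the
two translates of `l` agree, and a group element whose derivative at a fixed point is the identity
is trivial. As `W` is connected, one `g` serves everywhere.

Consequently every loop of the orbifold groupoid is `[id, x, λ_g]` for exactly one `x` and one `g`
with `g x = x`, so the objects of the inertia groupoid are `⊔ₚ ⊔_{g ∈ G_p} V_p^g`
(`loopHomeomorph`). An arrow `[l, w, r]` conjugates the loop of `g` at `l(w)` to the loop of `h` at
`r(w)` exactly when `g` and `h` are the images of one `k` in the group of `W`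
(`fixedLoop_conj_iff`), and such a `k` fixes `w`. This is the condition defining the arrows of the
twisted sectors, which are therefore the full subgroupoid of the inertia groupoid on the open set of
loops of chosen representatives (`sectorIncl`).

Each `g` is carried to its representative by conjugation with some `z`, and `[id, x, λ_z]` joins the
loop of `g` at `x` to the loop of the representative at `z x`. Since `z` depends on `g` only, it is
constant on the open piece `V_p^g`, so any choice is continuous. A fully faithful embedding with
such a continuous choice of arrows has a Morita quasi-inverse `M` (`exists_isMorita_of_retraction`);
the identity and `M` form the Morita equivalence. Over a single `p`, writing `r = λ_z l` shows that
`z` conjugates one representative to another, so the two classes coincide and `z` centralizes the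
representative. -/

/-! ## Finite order diffeomorphisms with trivial derivative at a fixed point -/

/-- A map of finite order near a fixed point at which its derivative is the identity is
the identity near that point. -/
theorem HasStrictFDerivAt.eventuallyEq_id_of_iterate {E : Type*} [NormedAddCommGroup E]
    [NormedSpace ℝ E] [CompleteSpace E] {φ : E → E} {a : E}
    (hφ : HasStrictFDerivAt φ (ContinuousLinearMap.id ℝ E) a) (ha : φ a = a) {N : ℕ} (hN : 0 < N)
    (hper : ∀ᶠ y in 𝓝 a, φ^[N] y = y) : ∀ᶠ y in 𝓝 a, φ y = y := by
  -- The average of the iterates is invariant under `φ` near `a`, and its derivative at `a` is the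
  -- identity, so it is injective near `a`; hence `φ y` and `y` coincide.
  let s : E → E := fun y => (N : ℝ)⁻¹ • ∑ i ∈ Finset.range N, φ^[i] y
  have hpow : ∀ i : ℕ, (ContinuousLinearMap.id ℝ E) ^ i = ContinuousLinearMap.id ℝ E :=
    fun i => one_pow i
  have hder : HasStrictFDerivAt s
      ((ContinuousLinearEquiv.refl ℝ E : E ≃L[ℝ] E) : E →L[ℝ] E) a := by
    have h1 := (HasStrictFDerivAt.fun_sum (u := Finset.range N)
      fun i _ => hφ.iterate ha i).const_smul ((N : ℝ)⁻¹)
    have hL : (N : ℝ)⁻¹ • ∑ i ∈ Finset.range N, (ContinuousLinearMap.id ℝ E) ^ i =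
        ((ContinuousLinearEquiv.refl ℝ E : E ≃L[ℝ] E) : E →L[ℝ] E) := by
      simp only [hpow]
      rw [Finset.sum_const, Finset.card_range, ← Nat.cast_smul_eq_nsmul ℝ, smul_smul,
        inv_mul_cancel₀ (Nat.cast_ne_zero.2 hN.ne'), one_smul]
      rfl
    rw [hL] at h1
    exact h1
  have hc : Filter.Tendsto φ (𝓝 a) (𝓝 a) := by
    have := hφ.continuousAt.tendsto
    rwa [ha] at this
  have hinj := hder.eventually_left_inverse
  filter_upwards [hper, hinj, hc.eventually hinj] with y h1 h2 h3
  have h4 : s (φ y) = s y := by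
    -- The sum of `N + 1` iterates is split off at its last and at its first term; both terms equal
    -- `y`.
    have h5 := Finset.sum_range_succ (fun i => φ^[i] y) N
    rw [Finset.sum_range_succ', h1] at h5
    simp only [s, ← Function.iterate_succ_apply]
    rw [add_right_cancel h5]
  rw [← h3, h4, h2]

/-! ### Derivatives of a finite group action at fixed points -/

section FixedPoints

variable {n : ℕ} {V : Type u} [TopologicalSpace V] [ChartedSpace (EuclideanSpace ℝ (Fin n)) V]
  {G : Type w} [Group G] [Finite G] [MulAction G V]

/-- A group element with trivial derivative at a fixed point acts trivially near that point. -/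
theorem mem_interior_fixedBy_of_fderiv_eq_id
    (hs : ∀ g : G, ContMDiff (𝓡 n) (𝓡 n) ∞ (fun x : V => g • x)) {g : G} {x : V}
    (hx : g • x = x)
    (hd : fderiv ℝ (fun y => extChartAt (𝓡 n) x (g • (extChartAt (𝓡 n) x).symm y))
      (extChartAt (𝓡 n) x x) = ContinuousLinearMap.id ℝ (EuclideanSpace ℝ (Fin n))) :
    x ∈ interior (MulAction.fixedBy V g) := by
  set e := extChartAt (𝓡 n) x with he
  set φ : EuclideanSpace ℝ (Fin n) → EuclideanSpace ℝ (Fin n) := fun y => e (g • e.symm y) with hφ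
  have hxs : x ∈ e.source := mem_extChartAt_source x
  have hstrict : HasStrictFDerivAt φ (ContinuousLinearMap.id ℝ (EuclideanSpace ℝ (Fin n)))
      (e x) := by
    have h1 := ((contMDiffAt_iff.1 ((hs g) x)).2)
    rw [hx, ModelWithCorners.range_eq_univ, contDiffWithinAt_univ] at h1
    have h3 := ContDiffAt.hasStrictFDerivAt (f := φ) h1 (by simp)
    rwa [hd] at h3
  have hfix : φ (e x) = e x := by simp only [hφ, e.left_inv hxs, hx]
  have hsymm : Filter.Tendsto e.symm (𝓝 (e x)) (𝓝 x) := by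
    have := (continuousAt_extChartAt_symm (I := 𝓡 n) x).tendsto
    rwa [← he, e.left_inv hxs] at this
  have hgx : ∀ i : ℕ, g ^ i • x = x := fun i =>
    (MulAction.stabilizer G x).pow_mem (show g ∈ MulAction.stabilizer G x from hx) i
  have hsmul : ∀ i : ℕ, Filter.Tendsto (fun z : V => g ^ i • z) (𝓝 x) (𝓝 x) := fun i => by
    have := (hs (g ^ i)).continuous.tendsto x
    rwa [hgx i] at this
  -- Outside the chart domain `φ` has no meaning, so its iterates compute the powers of `g` only on
  -- a neighbourhood depending on `i`; since `g ^ i` fixes `x`, points near `x` stay in the chart.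
  have hiter : ∀ i : ℕ, ∀ᶠ y in 𝓝 (e x), φ^[i] y = e (g ^ i • e.symm y) := by
    intro i
    induction i with
    | zero =>
      filter_upwards [extChartAt_target_mem_nhds (I := 𝓡 n) x] with y hy
      rw [pow_zero, one_smul]
      exact (e.right_inv hy).symm
    | succ i ih =>
      filter_upwards [ih, hsymm.eventually ((hsmul i).eventually
        (extChartAt_source_mem_nhds (I := 𝓡 n) x))] with y h1 h2
      rw [Function.iterate_succ_apply', h1]
      change e (g • e.symm (e _)) = _
      rw [e.left_inv h2, pow_succ', mul_smul]
  have hper : ∀ᶠ y in 𝓝 (e x), φ^[orderOf g] y = y := by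
    filter_upwards [hiter (orderOf g), extChartAt_target_mem_nhds (I := 𝓡 n) x] with y h1 h2
    rw [h1, pow_orderOf_eq_one, one_smul]
    exact e.right_inv h2
  have hid := hstrict.eventuallyEq_id_of_iterate hfix (orderOf_pos g) hper
  rw [mem_interior_iff_mem_nhds]
  have h1 := hsmul 1
  rw [pow_one] at h1
  filter_upwards [(continuousAt_extChartAt (I := 𝓡 n) x).eventually hid,
    extChartAt_source_mem_nhds (I := 𝓡 n) x,
    h1.eventually (extChartAt_source_mem_nhds (I := 𝓡 n) x)] with z h2 h3 h4
  simp only [hφ, ← he, e.left_inv h3] at h2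
  exact e.injOn h4 h3 h2

/-- Two smooth maps that agree on an open set have the same derivative at each point of its
closure. -/
theorem fderiv_extChartAt_eq_of_mem_closure {W : Type*} [TopologicalSpace W]
    [ChartedSpace (EuclideanSpace ℝ (Fin n)) W] {f f' : W → V}
    (hf : ContMDiff (𝓡 n) (𝓡 n) ∞ f) (hf' : ContMDiff (𝓡 n) (𝓡 n) ∞ f') {x : W} {y : V}
    (hy : f x = y) (hy' : f' x = y) (hx : x ∈ closure (interior {z | f z = f' z})) :
    fderiv ℝ (fun z => extChartAt (𝓡 n) y (f ((extChartAt (𝓡 n) x).symm z)))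
      (extChartAt (𝓡 n) x x) =
    fderiv ℝ (fun z => extChartAt (𝓡 n) y (f' ((extChartAt (𝓡 n) x).symm z)))
      (extChartAt (𝓡 n) x x) := by
  set e := extChartAt (𝓡 n) x with he
  -- With the charts at `x` and `y` held fixed, the derivative is continuous in the base point at
  -- `x`. The two derivatives agree at points arbitrarily close to `x`, so their limits at `x` are
  -- equal.
  have hcont : ∀ k : W → V, ContMDiff (𝓡 n) (𝓡 n) ∞ k → k x = y → ContinuousAt
      (fun z => fderiv ℝ (fun z => extChartAt (𝓡 n) y (k (e.symm z))) (e z)) x := by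
    intro k hk hky
    have h1 := ((contMDiffAt_iff.1 (hk x)).2)
    rw [hky, ModelWithCorners.range_eq_univ, contDiffWithinAt_univ] at h1
    have h2 := (h1.fderiv_right (m := 0) (by simp)).continuousAt
    exact ContinuousAt.comp (g := fderiv ℝ (fun z => extChartAt (𝓡 n) y (k (e.symm z)))) h2
      (continuousAt_extChartAt x)
  have h1 := hcont f hf hy
  have h2 := hcont f' hf' hy'
  refine tendsto_nhds_unique_of_frequently_eq h1 h2 ?_
  refine ((mem_closure_iff_frequently.1 hx).and_eventually
    (extChartAt_source_mem_nhds (I := 𝓡 n) x)).mono ?_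
  rintro z ⟨hz, hzs⟩
  have hc : ContinuousAt e.symm (e z) := (continuousOn_extChartAt_symm x).continuousAt
    ((isOpen_extChartAt_target x).mem_nhds (e.map_source hzs))
  have hmem : ∀ᶠ t in 𝓝 (e z), e.symm t ∈ interior {z | f z = f' z} :=
    hc.eventually (by rw [e.left_inv hzs]; exact isOpen_interior.mem_nhds hz)
  refine Filter.EventuallyEq.fderiv_eq ?_
  filter_upwards [hmem] with t ht
  have ht' : f (e.symm t) = f' (e.symm t) :=
    interior_subset (s := {z | f z = f' z}) ht
  rw [ht']

/-- If `f` and `g • f` agree with the same smooth map on open sets whose closures meet, then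
`g = 1`. -/
theorem eq_one_of_mem_closure_interior [IsManifold (𝓡 n) ∞ V] [T2Space V] [ConnectedSpace V]
    [FaithfulSMul G V] (hs : ∀ g : G, ContMDiff (𝓡 n) (𝓡 n) ∞ (fun x : V => g • x)) {W : Type*}
    [TopologicalSpace W] [ChartedSpace (EuclideanSpace ℝ (Fin n)) W] [IsManifold (𝓡 n) ∞ W]
    {f f' : W → V} (hf : IsLocalDiffeomorph (𝓡 n) (𝓡 n) ∞ f)
    (hf' : ContMDiff (𝓡 n) (𝓡 n) ∞ f') {g : G} {x : W}
    (hx : x ∈ closure (interior {z | f z = f' z}))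
    (hx' : x ∈ closure (interior {z | g • f z = f' z})) : g = 1 := by
  have hgf : ContMDiff (𝓡 n) (𝓡 n) ∞ (fun z => g • f z) := (hs g).comp hf.contMDiff
  have h1 : f x = f' x := (isClosed_eq hf.contMDiff.continuous
    hf'.continuous).closure_subset_iff.2 interior_subset hx
  have h2 : g • f x = f' x := (isClosed_eq hgf.continuous
    hf'.continuous).closure_subset_iff.2 interior_subset hx'
  have hg : g • f x = f x := h2.trans h1.symm
  -- At `x` the derivatives of `g • f` and of `f` both equal that of `f'`.
  have key := (fderiv_extChartAt_eq_of_mem_closure hgf hf' hg h1.symm hx').trans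
    (fderiv_extChartAt_eq_of_mem_closure hf.contMDiff hf' rfl h1.symm hx).symm
  have hmem : f x ∈ interior (MulAction.fixedBy V g) := by
    refine mem_interior_fixedBy_of_fderiv_eq_id hs hg ?_
    set e := extChartAt (𝓡 n) x with he
    set e' := extChartAt (𝓡 n) (f x) with he'
    have hxs : x ∈ e.source := mem_extChartAt_source x
    have hF : DifferentiableAt ℝ (fun z => e' (f (e.symm z))) (e x) := by
      have h := ((contMDiffAt_iff.1 (hf.contMDiff x)).2)
      rw [ModelWithCorners.range_eq_univ, contDiffWithinAt_univ] at h
      exact ContDiffAt.differentiableAt h (by simp)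
    have hK : DifferentiableAt ℝ (fun z => e' (g • e'.symm z)) (e' (f x)) := by
      have h := ((contMDiffAt_iff.1 (hs g (f x))).2)
      rw [hg, ModelWithCorners.range_eq_univ, contDiffWithinAt_univ] at h
      exact ContDiffAt.differentiableAt h (by simp)
    have hK' : DifferentiableAt ℝ (fun z => e' (g • e'.symm z)) (e' (f (e.symm (e x)))) := by
      rwa [e.left_inv hxs]
    -- By the chain rule `Dg ∘ Df = Df`; as `f` is a local diffeomorphism, `Df` is surjective and
    -- `Dg` is the identity at `f x`.
    have hcomp := fderiv_comp (e x) hK' hF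
    have heq : ((fun z => e' (g • e'.symm z)) ∘ fun z => e' (f (e.symm z))) =ᶠ[𝓝 (e x)]
        fun z => e' (g • f (e.symm z)) := by
      have hsymm : Filter.Tendsto e.symm (𝓝 (e x)) (𝓝 x) := by
        have := (continuousAt_extChartAt_symm (I := 𝓡 n) x).tendsto
        rwa [← he, e.left_inv hxs] at this
      filter_upwards [hsymm.eventually (hf.contMDiff.continuous.continuousAt.eventually
        (extChartAt_source_mem_nhds (I := 𝓡 n) (f x)))] with z hz
      simp only [Function.comp]
      rw [e'.left_inv hz]
    rw [heq.fderiv_eq, key, e.left_inv hxs] at hcomp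
    have hsurj : Function.Surjective (fderiv ℝ (fun z => e' (f (e.symm z))) (e x)) := by
      have h := ((hf x).mfderivToContinuousLinearEquiv (by simp)).surjective
      have h3 : (mfderiv (𝓡 n) (𝓡 n) f x : EuclideanSpace ℝ (Fin n) →L[ℝ]
          EuclideanSpace ℝ (Fin n)) = fderiv ℝ (fun z => e' (f (e.symm z))) (e x) := by
        refine (hf.mdifferentiable (by simp) x).mfderiv.trans ?_
        rw [ModelWithCorners.range_eq_univ, fderivWithin_univ]
        rfl
      rw [← h3]
      exact h
    ext1 t
    obtain ⟨s, rfl⟩ := hsurj t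
    exact (DFunLike.congr_fun hcomp s).symm
  by_contra hne
  rw [interior_fixedBy_eq_empty hs hne] at hmem
  exact hmem

end FixedPoints

/-! ### Embeddings into a chart, up to its group -/

namespace OrbifoldChart

variable {n : ℕ} {X : Type v} [TopologicalSpace X] {A B : OrbifoldChart.{u, v} n X}

/-- If the homomorphisms differed at `a`, the quotient of the two values would be a non-trivial
element fixing the nonempty open image pointwise, against effectiveness on a connected chart.
Equalities of embeddings thus reduce to equalities of maps. -/
theorem Embedding.eq_of_toFun_eq {f f' : A ⟶ B} (h : f.toFun = f'.toFun) : f = f' := by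
  refine Embedding.ext h (MonoidHom.ext fun a => ?_)
  by_contra hne
  have h1 : (f'.hom a)⁻¹ * f.hom a ≠ 1 := fun e => hne (inv_mul_eq_one.1 e).symm
  have h2 : Set.range f.toFun ⊆ MulAction.fixedBy B.V ((f'.hom a)⁻¹ * f.hom a) := by
    rintro _ ⟨x, rfl⟩
    change ((f'.hom a)⁻¹ * f.hom a) • f.toFun x = f.toFun x
    rw [mul_smul, ← f.equivariant, h, f'.equivariant, inv_smul_smul]
  have h3 := interior_maximal h2 f.isOpenEmbedding.isOpen_range
  rw [interior_fixedBy_eq_empty B.smooth h1] at h3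
  obtain ⟨x⟩ : Nonempty A.V := inferInstance
  exact h3 ⟨x, rfl⟩

/-- Two embeddings into the same chart differ by an element of its group. -/
theorem Embedding.exists_comp_translate (f f' : A ⟶ B) : ∃ g, f ≫ B.translate g = f' := by
  have hc : ∀ g : B.G, ContMDiff (𝓡 n) (𝓡 n) ∞ (fun z => g • f.toFun z) := fun g =>
    (B.smooth g).comp f.isLocalDiffeomorph.contMDiff
  -- The sets `C g` are closed and cover, because `f z` and `f' z` have the same image in `X`.
  let C : B.G → Set A.V := fun g => {z | g • f.toFun z = f'.toFun z}
  have hC : ∀ g, IsClosed (C g) := fun g =>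
    isClosed_eq (hc g).continuous f'.isOpenEmbedding.continuous
  have hU : ⋃ g, C g = Set.univ := Set.eq_univ_of_forall fun z => by
    obtain ⟨g, hg⟩ := (B.π_eq_iff (f.toFun z) (f'.toFun z)).1
      ((f.π_comp z).trans (f'.π_comp z).symm)
    exact Set.mem_iUnion.2 ⟨g, hg⟩
  have : LocallyCompactSpace A.V := Manifold.locallyCompact_of_finiteDimensional (𝓡 n)
  -- Baire makes the union of the interiors dense; the group is finite, so closure commutes with
  -- this union.
  have hcov : ⋃ g, closure (interior (C g)) = Set.univ := by
    rw [← closure_iUnion_of_finite]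
    exact (dense_iUnion_interior_of_closed hC hU).closure_eq
  -- Replacing `f` by `λ_g f` and `h` by `h g⁻¹` reduces disjointness to
  -- `eq_one_of_mem_closure_interior`.
  have hdisj : ∀ g h x, x ∈ closure (interior (C g)) → x ∈ closure (interior (C h)) → g = h := by
    intro g h x hg hh
    refine (mul_inv_eq_one.1 (eq_one_of_mem_closure_interior B.smooth
      (f ≫ B.translate g).isLocalDiffeomorph f'.isLocalDiffeomorph.contMDiff
      (g := h * g⁻¹) (x := x) hg ?_)).symm
    convert hh using 5 with z
    change (h * g⁻¹) • g • f.toFun z = f'.toFun z ↔ _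
    rw [smul_smul, inv_mul_cancel_right]
  obtain ⟨x⟩ : Nonempty A.V := inferInstance
  obtain ⟨g, hg⟩ := Set.mem_iUnion.1 (hcov ▸ Set.mem_univ x)
  -- The complement is the finite union of the other closures, so the piece is clopen in a connected
  -- space.
  have hopen : IsOpen (closure (interior (C g))) := by
    have h1 : closure (interior (C g)) = (⋃ h : {h // h ≠ g}, closure (interior (C h)))ᶜ := by
      ext z
      simp only [Set.mem_compl_iff, Set.mem_iUnion, not_exists]
      constructor
      · exact fun hz h hz' => h.2 (hdisj _ _ z hz' hz)
      · intro hz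
        obtain ⟨h, hh⟩ := Set.mem_iUnion.1 (hcov ▸ Set.mem_univ z)
        by_cases e : h = g
        · exact e ▸ hh
        · exact absurd hh (hz ⟨h, e⟩)
    rw [h1]
    exact (isClosed_iUnion_of_finite fun _ => isClosed_closure).isOpen_compl
  have huniv := IsClopen.eq_univ ⟨isClosed_closure, hopen⟩ ⟨x, hg⟩
  refine ⟨g, eq_of_toFun_eq (funext fun z => ?_)⟩
  exact (hC g).closure_subset_iff.2 interior_subset (huniv ▸ Set.mem_univ z)

/-- Effectiveness again: `h⁻¹ g` fixes the open image of `f` pointwise, which only the identity can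
do. -/
theorem Embedding.translate_injective (f : A ⟶ B) {g h : B.G}
    (e : f ≫ B.translate g = f ≫ B.translate h) : g = h := by
  by_contra hne
  have h1 : h⁻¹ * g ≠ 1 := fun e => hne (inv_mul_eq_one.1 e).symm
  have h2 : Set.range f.toFun ⊆ MulAction.fixedBy B.V (h⁻¹ * g) := by
    rintro _ ⟨x, rfl⟩
    have h3 : g • f.toFun x = h • f.toFun x := congrFun (congrArg Embedding.toFun e) x
    change (h⁻¹ * g) • f.toFun x = f.toFun x
    rw [mul_smul, h3, inv_smul_smul]
  have h3 := interior_maximal h2 f.isOpenEmbedding.isOpen_range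
  rw [interior_fixedBy_eq_empty B.smooth h1] at h3
  obtain ⟨x⟩ : Nonempty A.V := inferInstance
  exact h3 ⟨x, rfl⟩

theorem Embedding.translate_comp (f : A ⟶ B) (k : A.G) :
    A.translate k ≫ f = f ≫ B.translate (f.hom k) :=
  eq_of_toFun_eq (funext fun x => f.equivariant k x)

end OrbifoldChart

/-! ## Quasi-inverses of fully faithful morphisms -/

/-- The base change of an open map along a continuous map is open. -/
theorem isOpenMap_snd_pullback {A B D : Type*} [TopologicalSpace A] [TopologicalSpace B]
    [TopologicalSpace D] {f : A → D} {g : B → D} (hf : IsOpenMap f) (hg : Continuous g) :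
    IsOpenMap fun p : {p : A × B // f p.1 = g p.2} => p.1.2 := by
  intro U hU
  rw [isOpen_iff_mem_nhds]
  rintro _ ⟨⟨⟨v, a⟩, hva⟩, hp, rfl⟩
  obtain ⟨U', hU', rfl⟩ := isOpen_induced_iff.1 hU
  obtain ⟨S, T, hS, hT, hvS, haT, hST⟩ := isOpen_prod_iff.1 hU' v a hp
  have h2 : g ⁻¹' (f '' S) ∩ T ∈ 𝓝 a :=
    (((hf S hS).preimage hg).inter hT).mem_nhds ⟨⟨v, hvS, hva⟩, haT⟩
  filter_upwards [h2]
  rintro b ⟨⟨x, hx, e⟩, hb⟩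
  exact ⟨⟨(x, b), e⟩, hST ⟨hx, hb⟩, rfl⟩

namespace TopGroupoid

/-! ### Cancellation in groupoids and openness of the inertia source map -/

section Algebra

variable (G : TopGroupoid.{u, v})

theorem comp_comp_inv (a b : G.Arr) (h : G.tgt a = G.src b) :
    G.comp (G.comp a b h) (G.inv b) (by rw [G.tgt_comp, G.src_inv]) = a := by
  rw [G.assoc _ _ _ h (G.src_inv b).symm, G.comp_congr rfl (G.comp_inv b),
    G.comp_congr rfl (congrArg G.one h.symm)]
  exact G.comp_one a

theorem comp_inv_comp (a b : G.Arr) (h : G.tgt a = G.tgt b) :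
    G.comp (G.comp a (G.inv b) (h.trans (G.src_inv b).symm)) b (by rw [G.tgt_comp, G.tgt_inv]) =
      a := by
  rw [G.assoc _ _ _ (h.trans (G.src_inv b).symm) (G.tgt_inv b), G.comp_congr rfl (G.inv_comp b),
    G.comp_congr rfl (congrArg G.one h.symm)]
  exact G.comp_one a

theorem inv_comp_comp (a b : G.Arr) (h : G.tgt a = G.src b) :
    G.comp (G.inv a) (G.comp a b h) (by rw [G.src_comp, G.tgt_inv]) = b := by
  rw [← G.assoc _ _ _ (G.tgt_inv a) h, G.comp_congr (G.inv_comp a) rfl,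
    G.comp_congr (congrArg G.one h) rfl]
  exact G.one_comp b

theorem comp_inv_comp_self (a b : G.Arr) (h : G.src a = G.src b) :
    G.comp a (G.comp (G.inv a) b ((G.tgt_inv a).trans h)) (by rw [G.src_comp, G.src_inv]) = b := by
  rw [← G.assoc _ _ _ (G.src_inv a).symm ((G.tgt_inv a).trans h), G.comp_congr (G.comp_inv a) rfl,
    G.comp_congr (congrArg G.one h) rfl]
  exact G.one_comp b

theorem comp_left_cancel {a b b' : G.Arr} {h : G.tgt a = G.src b} {h' : G.tgt a = G.src b'}
    (e : G.comp a b h = G.comp a b' h') : b = b' := by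
  rw [← G.inv_comp_comp a b h, ← G.inv_comp_comp a b' h']
  exact G.comp_congr rfl e _

/-- An inertia arrow `v ⟶ w` is determined by `v` and `α`, because `w = α⁻¹ v α`. So the arrow space
is the fibre product of the arrows and the loops over the objects, and the source map is a base
change of `G.src`. -/
theorem isOpenMap_inertia_src (ho : IsOpenMap G.src) : IsOpenMap G.inertia.src := by
  intro U hU
  have h1 : ∀ p : {p : G.Arr × G.Loop // G.src p.1 = G.src p.2.1},
      G.tgt (G.inv p.1.1) = G.src p.1.2.1 := fun p => (G.tgt_inv _).trans p.2
  have h2 : ∀ p : {p : G.Arr × G.Loop // G.src p.1 = G.src p.2.1},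
      G.tgt (G.comp (G.inv p.1.1) p.1.2.1 (h1 p)) = G.src p.1.1 := fun p =>
    (G.tgt_comp _ _ _).trans (p.1.2.2.symm.trans p.2.symm)
  -- For `p = (α, v)` this is `α⁻¹ v α`.
  let w : {p : G.Arr × G.Loop // G.src p.1 = G.src p.2.1} → G.Loop := fun p =>
    ⟨G.comp (G.comp (G.inv p.1.1) p.1.2.1 (h1 p)) p.1.1 (h2 p), by
      rw [G.src_comp, G.src_comp, G.src_inv, G.tgt_comp]⟩
  have hv : ∀ p : {p : G.Arr × G.Loop // G.src p.1 = G.src p.2.1},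
      G.tgt p.1.2.1 = G.src p.1.1 := fun p => p.1.2.2.symm.trans p.2.symm
  have hw : ∀ p, G.tgt p.1.1 = G.src (w p).1 := fun p =>
    ((G.src_comp _ _ _).trans ((G.src_comp _ _ _).trans (G.src_inv _))).symm
  have hc : ∀ p, G.comp p.1.2.1 p.1.1 (hv p) = G.comp p.1.1 (w p).1 (hw p) := fun p =>
    ((G.comp_congr rfl (G.assoc _ _ _ (h1 p) (hv p)) _).trans
      (G.comp_inv_comp_self _ _ (p.2.trans (G.src_comp _ _ _).symm))).symm
  let σ : {p : G.Arr × G.Loop // G.src p.1 = G.src p.2.1} → G.LoopArr := fun p =>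
    ⟨(p.1.2, p.1.1, w p), hv p, hw p, hc p⟩
  have hwc : Continuous w := Continuous.subtype_mk (G.continuous_comp' (G.continuous_comp'
    (G.continuous_inv.comp (by fun_prop)) (by fun_prop) _) (by fun_prop) _) _
  have hσ : Continuous σ := Continuous.subtype_mk (Continuous.prodMk (by fun_prop)
    (Continuous.prodMk (by fun_prop) hwc)) _
  have h3 : G.inertia.src '' U = (fun p : {p : G.Arr × G.Loop // G.src p.1 = G.src p.2.1} =>
      p.1.2) '' (σ ⁻¹' U) := by
    refine Set.Subset.antisymm ?_ ?_
    · rintro _ ⟨⟨⟨v, α, w'⟩, h, h', e⟩, hp, rfl⟩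
      let p : {p : G.Arr × G.Loop // G.src p.1 = G.src p.2.1} := ⟨(α, v), h.symm.trans v.2.symm⟩
      refine ⟨p, ?_, rfl⟩
      have h4 : w p = w' := Subtype.ext (G.comp_left_cancel ((hc p).symm.trans e))
      have h5 : σ p = ⟨(v, α, w'), h, h', e⟩ := Subtype.ext (Prod.ext rfl (Prod.ext rfl h4))
      exact (congrArg (· ∈ U) h5).mpr hp
    · rintro _ ⟨p, hp, rfl⟩
      exact ⟨σ p, hp, rfl⟩
  rw [h3]
  exact isOpenMap_snd_pullback ho (G.continuous_src.comp continuous_subtype_val) _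
    (hU.preimage hσ)

end Algebra

/-! ### Morita morphisms: the identity and quasi-inverses -/

/-- The identity morphism. -/
def Hom.id (G : TopGroupoid.{u, v}) : Hom G G where
  obj x := x
  arr a := a
  continuous_obj := continuous_id
  continuous_arr := continuous_id
  src_arr _ := rfl
  tgt_arr _ := rfl
  arr_one _ := rfl
  arr_inv _ := rfl
  arr_comp _ _ _ := rfl

/-- For the identity, `s ∘ π₂` is the source map up to a homeomorphism, which is why openness of the
source is needed. This turns a single Morita morphism out of `G` into a Morita equivalence. -/
theorem Hom.isMorita_id (G : TopGroupoid.{u, v}) (ho : IsOpenMap G.src) :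
    (Hom.id G).IsMorita where
  cartesian := by
    let e : G.Arr ≃ₜ {p : (G.Obj × G.Obj) × G.Arr // p.1.1 = G.src p.2 ∧ p.1.2 = G.tgt p.2} :=
      { toFun := fun a => ⟨((G.src a, G.tgt a), a), rfl, rfl⟩
        invFun := fun p => p.1.2
        left_inv := fun _ => rfl
        right_inv := fun p => Subtype.ext (Prod.ext (Prod.ext p.2.1.symm p.2.2.symm) rfl)
        continuous_toFun := Continuous.subtype_mk
          ((G.continuous_src.prodMk G.continuous_tgt).prodMk continuous_id) _
        continuous_invFun := continuous_snd.comp continuous_subtype_val }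
    exact e.isHomeomorph
  isOpenMap := by
    let e : {p : G.Obj × G.Arr // p.1 = G.tgt p.2} ≃ₜ G.Arr :=
      { toFun := fun p => p.1.2
        invFun := fun a => ⟨(G.tgt a, a), rfl⟩
        left_inv := fun p => Subtype.ext (Prod.ext p.2.symm rfl)
        right_inv := fun _ => rfl
        continuous_toFun := continuous_snd.comp continuous_subtype_val
        continuous_invFun := Continuous.subtype_mk (G.continuous_tgt.prodMk continuous_id) _ }
    exact ho.comp e.isOpenMap
  surjective x := ⟨⟨(x, G.one x), (G.tgt_one x).symm⟩, G.src_one x⟩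

/-- A fully faithful embedding `ι` of topological groupoids, together with a continuous choice
`ζ v : v ⟶ ι (r v)` of arrows, has a quasi-inverse, which is Morita if `r` and the source map
are open. -/
theorem Hom.exists_isMorita_of_retraction {T : TopGroupoid.{u, v}} {G : TopGroupoid.{w, w₁}}
    (ι : Hom T G) (hobj : Function.Injective ι.obj) (harr : IsEmbedding ι.arr)
    (hfull : ∀ x y (β : G.Arr), G.src β = ι.obj x → G.tgt β = ι.obj y → ∃ a, ι.arr a = β)
    (r : G.Obj → T.Obj) (hr : Continuous r) (hro : IsOpenMap r) (ζ : G.Obj → G.Arr)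
    (hζ : Continuous ζ) (hs : ∀ v, G.src (ζ v) = v) (ht : ∀ v, G.tgt (ζ v) = ι.obj (r v))
    (ho : IsOpenMap T.src) : ∃ M : Hom G T, M.IsMorita := by
  have htα : ∀ α, G.tgt α = G.src (ζ (G.tgt α)) := fun α => (hs _).symm
  have hsα : ∀ α, G.tgt (G.inv (ζ (G.src α))) = G.src (G.comp α (ζ (G.tgt α)) (htα α)) :=
    fun α => by rw [G.tgt_inv, hs, G.src_comp]
  -- Transport of `α` along `ζ` at both ends; the result runs between objects in the image of `ι`,
  -- so it lifts to `T`.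
  let K : G.Arr → G.Arr := fun α =>
    G.comp (G.inv (ζ (G.src α))) (G.comp α (ζ (G.tgt α)) (htα α)) (hsα α)
  have hKs : ∀ α, G.src (K α) = ι.obj (r (G.src α)) := fun α => by
    rw [G.src_comp, G.src_inv, ht]
  have hKt : ∀ α, G.tgt (K α) = ι.obj (r (G.tgt α)) := fun α => by
    rw [G.tgt_comp, G.tgt_comp, ht]
  choose m hm using fun α => hfull _ _ (K α) (hKs α) (hKt α)
  have hms : ∀ α, T.src (m α) = r (G.src α) := fun α => hobj (by
    rw [← ι.src_arr, hm, hKs])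
  have hmt : ∀ α, T.tgt (m α) = r (G.tgt α) := fun α => hobj (by
    rw [← ι.tgt_arr, hm, hKt])
  have hζa : ∀ v a, T.src a = r v → G.tgt (ζ v) = G.src (ι.arr a) := fun v a h => by
    rw [ht, ι.src_arr, h]
  have hnat : ∀ α, G.comp (ζ (G.src α)) (ι.arr (m α)) (hζa _ _ (hms α)) =
      G.comp α (ζ (G.tgt α)) (htα α) := fun α =>
    (G.comp_congr rfl (hm α) _).trans (G.comp_inv_comp_self _ _ (by rw [hs, G.src_comp]))
  -- The lift is characterized by the naturality square of `ζ`; compatibility with units and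
  -- composition is checked by verifying this square.
  have huniq : ∀ α a (h : T.src a = r (G.src α)),
      G.comp (ζ (G.src α)) (ι.arr a) (hζa _ _ h) = G.comp α (ζ (G.tgt α)) (htα α) → m α = a :=
    fun α a h e => harr.injective (G.comp_left_cancel ((hnat α).trans e.symm))
  -- The lifts are chosen pointwise, yet `m` is continuous because `ι.arr` is inducing and `ι.arr ∘
  -- m` is the continuous map `K`.
  have hmc : Continuous m := by
    rw [harr.isInducing.continuous_iff]
    have : ι.arr ∘ m = K := funext hm
    rw [this]
    exact G.continuous_comp' (G.continuous_inv.comp (hζ.comp G.continuous_src))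
      (G.continuous_comp' continuous_id (hζ.comp G.continuous_tgt) _) _
  have hmone : ∀ x, m (G.one x) = T.one (r x) := fun x => by
    refine huniq _ _ (by rw [T.src_one, G.src_one]) ?_
    rw [G.comp_congr (congrArg ζ (G.src_one x)) ((ι.arr_one (r x)).trans
      (congrArg G.one (ht x).symm)), G.comp_congr (a := G.one x) (b := ζ (G.tgt (G.one x)))
      (congrArg G.one (hs x).symm) (congrArg ζ (G.tgt_one x)), G.comp_one, G.one_comp]
  have hmcomp : ∀ a b (h : G.tgt a = G.src b),
      m (G.comp a b h) = T.comp (m a) (m b) (by rw [hmt, hms, h]) := fun a b h => by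
    have hab : T.tgt (m a) = T.src (m b) := by rw [hmt, hms, h]
    have hab' : G.tgt (ι.arr (m a)) = G.src (ι.arr (m b)) := by rw [ι.tgt_arr, ι.src_arr, hab]
    have h1 : G.tgt (ζ (G.tgt a)) = G.src (ι.arr (m b)) := hζa _ _ (by rw [hms, h])
    refine huniq _ _ (by rw [T.src_comp, hms, G.src_comp]) ?_
    rw [G.comp_congr (congrArg ζ (G.src_comp a b h)) (ι.arr_comp _ _ hab),
      ← G.assoc _ _ _ (hζa _ _ (hms a)) hab', G.comp_congr (hnat a) rfl,
      G.assoc _ _ _ (htα a) h1, G.comp_congr rfl ((G.comp_congr (congrArg ζ h) rfl _).trans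
      (hnat b)), G.comp_congr (a := G.comp a b h) rfl (congrArg ζ (G.tgt_comp a b h)),
      G.assoc _ _ _ h (htα b)]
  have hminv : ∀ a, m (G.inv a) = T.inv (m a) := fun a => by
    have h1 : T.tgt (m a) = T.src (m (G.inv a)) := by rw [hmt, hms, G.src_inv]
    have h2 : T.comp (m a) (m (G.inv a)) h1 =
        T.comp (m a) (T.inv (m a)) (T.src_inv _).symm := by
      rw [← hmcomp a (G.inv a) (G.src_inv a).symm, G.comp_inv, hmone, T.comp_inv, hms]
    exact T.comp_left_cancel h2
  let M : Hom G T :=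
    { obj := r
      arr := m
      continuous_obj := hr
      continuous_arr := hmc
      src_arr := hms
      tgt_arr := hmt
      arr_one := hmone
      arr_inv := hminv
      arr_comp := hmcomp }
  refine ⟨M, ?_, ?_, ?_⟩
  · have h1 : ∀ p : {p : (G.Obj × G.Obj) × T.Arr // r p.1.1 = T.src p.2 ∧ r p.1.2 = T.tgt p.2},
        G.tgt (ζ p.1.1.1) = G.src (ι.arr p.1.2) := fun p => hζa _ _ p.2.1.symm
    have h2 : ∀ p : {p : (G.Obj × G.Obj) × T.Arr // r p.1.1 = T.src p.2 ∧ r p.1.2 = T.tgt p.2},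
        G.tgt (G.comp (ζ p.1.1.1) (ι.arr p.1.2) (h1 p)) = G.tgt (ζ p.1.1.2) := fun p => by
      rw [G.tgt_comp, ι.tgt_arr, ht, p.2.2]
    -- The inverse sends `(v, w, a)` to `ζ v · ι a · (ζ w)⁻¹`.
    refine Homeomorph.isHomeomorph
      { toFun := fun a => ⟨((G.src a, G.tgt a), m a), (hms a).symm, (hmt a).symm⟩
        invFun := fun p => G.comp (G.comp (ζ p.1.1.1) (ι.arr p.1.2) (h1 p)) (G.inv (ζ p.1.1.2))
          ((h2 p).trans (G.src_inv _).symm)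
        left_inv := fun a => ?_
        right_inv := fun p => ?_
        continuous_toFun := Continuous.subtype_mk
          ((G.continuous_src.prodMk G.continuous_tgt).prodMk hmc) _
        continuous_invFun := ?_ }
    · exact (G.comp_congr (hnat a) rfl _).trans (G.comp_comp_inv _ _ (htα a))
    · obtain ⟨⟨⟨v, w⟩, a⟩, hv, hw⟩ := p
      dsimp only at hv hw
      refine Subtype.ext (Prod.ext (Prod.ext ?_ ?_) ?_)
      · exact (G.src_comp _ _ _).trans ((G.src_comp _ _ _).trans (hs v))
      · exact (G.tgt_comp _ _ _).trans ((G.tgt_inv _).trans (hs w))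
      · have hsv := (G.src_comp _ _ ((h2 ⟨⟨⟨v, w⟩, a⟩, hv, hw⟩).trans (G.src_inv _).symm)).trans
          ((G.src_comp _ _ _).trans (hs v))
        have htw := (G.tgt_comp _ _ ((h2 ⟨⟨⟨v, w⟩, a⟩, hv, hw⟩).trans (G.src_inv _).symm)).trans
          ((G.tgt_inv _).trans (hs w))
        refine huniq _ _ (hv.symm.trans (congrArg r hsv.symm)) ?_
        rw [G.comp_congr (congrArg ζ hsv) rfl]
        refine (G.comp_inv_comp _ _ (h2 ⟨⟨⟨v, w⟩, a⟩, hv, hw⟩)).symm.trans ?_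
        exact G.comp_congr rfl (congrArg ζ htw).symm _
    · exact G.continuous_comp' (G.continuous_comp' (by fun_prop)
        (ι.continuous_arr.comp (by fun_prop)) _) (G.continuous_inv.comp (by fun_prop)) _
  -- Here `s ∘ π₂` is the projection to `T.Arr`, a base change of the open map `r`, followed by the
  -- open source map of `T`.
  · intro U hU
    have h1 := isOpenMap_snd_pullback hro T.continuous_tgt U hU
    have h2 := ho _ h1
    rwa [Set.image_image] at h2
  -- The composite of `r` with `ι` need not be the identity; the lift of `ζ (ι t)` is an arrow from
  -- `t` to `r (ι t)`, which suffices.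
  · intro t
    have h1 : G.src (ζ (ι.obj t)) = ι.obj t := hs _
    obtain ⟨a, ha⟩ := hfull t (r (ι.obj t)) (ζ (ι.obj t)) h1 (ht _)
    refine ⟨⟨(ι.obj t, a), ?_⟩, ?_⟩
    · exact hobj (by rw [← ι.tgt_arr, ha, ht])
    · exact hobj (by rw [← ι.src_arr, ha, h1])

end TopGroupoid

/-- The arrow of `G` underlying an arrow of the inertia groupoid depends continuously on it. -/
theorem TopGroupoid.continuous_inertia_arr (G : TopGroupoid.{u, v}) :
    Continuous fun β : G.inertia.Arr => (β : G.LoopArr).1.2.1 :=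
  continuous_fst.comp (continuous_snd.comp continuous_subtype_val)

/-! ### Equality of classes of spans and openness of the source -/

namespace ChartCat

variable {C : Type w} [Category.{w₁} C] [ChartCat.{u} C] {I : Type v} {V : I → C}

theorem mk_eq_mk_iff {i j : I} {A A' : C} {l : A ⟶ V i} {r : A ⟶ V j} {l' : A' ⟶ V i}
    {r' : A' ⟶ V j} {a : Pt.{u} A} {a' : Pt.{u} A'} :
    (Quot.mk _ ⟨⟨i, j, A, l, r⟩, a⟩ : SpanArr V) = Quot.mk _ ⟨⟨i, j, A', l', r'⟩, a'⟩ ↔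
      ∃ (B : C) (ν : B ⟶ A) (ν' : B ⟶ A') (b : Pt.{u} B), map ν b = a ∧ map ν' b = a' ∧
        ν ≫ l = ν' ≫ l' ∧ ν ≫ r = ν' ≫ r' := by
  rw [mk_eq_iff]
  constructor
  · rintro ⟨W, h1, h2⟩
    cases h1 with
    | mk _ _ _ B _ _ ν l₁ r₁ b _ hb hl hr =>
      cases h2 with
      | mk _ _ _ _ _ _ μ _ _ _ _ hb' hl' hr' =>
        exact ⟨B, ν, μ, b, hb, hb', hl.trans hl'.symm, hr.trans hr'.symm⟩
  · rintro ⟨B, ν, ν', b, hb, hb', hl, hr⟩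
    exact ⟨⟨⟨i, j, B, ν ≫ l, ν ≫ r⟩, b⟩, Refines.mk _ _ _ _ _ _ _ _ _ _ _ hb rfl rfl,
      Refines.mk _ _ _ _ _ _ _ _ _ _ _ hb' hl.symm hr.symm⟩

/-- Left legs are monomorphisms, so with a shared left leg the two maps of a common refinement
coincide. -/
theorem mk_eq_mk_iff_right {i j : I} {A : C} {l : A ⟶ V i} {r r' : A ⟶ V j} {a : Pt.{u} A} :
    (Quot.mk _ ⟨⟨i, j, A, l, r⟩, a⟩ : SpanArr V) = Quot.mk _ ⟨⟨i, j, A, l, r'⟩, a⟩ ↔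
      ∃ (B : C) (ν : B ⟶ A) (b : Pt.{u} B), map ν b = a ∧ ν ≫ r = ν ≫ r' := by
  rw [mk_eq_mk_iff]
  constructor
  · rintro ⟨B, ν, ν', b, hb, hb', hl, hr⟩
    have := ChartCat.mono l
    obtain rfl := (cancel_mono l).1 hl
    exact ⟨B, ν, b, hb, hr⟩
  · rintro ⟨B, ν, b, hb, hr⟩
    exact ⟨B, ν, ν, b, hb, hb, rfl, hr⟩

/-- The span `(id, t)` is refined along `l` itself. This is the normal form `[id, x, λ_g]` of a
class whose right leg is a translate of its left leg. -/
theorem mk_comp_right {i j : I} {A : C} (l : A ⟶ V i) (t : V i ⟶ V j) (a : Pt.{u} A) :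
    (Quot.mk _ ⟨⟨i, j, A, l, l ≫ t⟩, a⟩ : SpanArr V) =
      Quot.mk _ ⟨⟨i, j, V i, 𝟙 _, t⟩, map l a⟩ :=
  Quot.sound (Refines.mk _ _ _ _ _ _ l _ _ _ _ rfl (Category.comp_id l) rfl)

theorem SpanArr.isOpenMap_src : IsOpenMap (SpanArr.src : SpanArr V → _) := by
  intro U hU
  have h : SpanArr.src '' U = ⋃ S : Span V, (Sigma.mk (β := fun i => Pt.{u} (V i)) S.i) ''
      (map S.left '' ((fun a => (Quot.mk _ ⟨S, a⟩ : SpanArr V)) ⁻¹' U)) := by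
    refine Set.Subset.antisymm ?_ ?_
    · rintro _ ⟨α, hα, rfl⟩
      induction α using Quot.ind with | _ T
      exact Set.mem_iUnion.2 ⟨T.1, _, ⟨T.2, hα, rfl⟩, rfl⟩
    · rintro x hx
      obtain ⟨S, _, ⟨a, ha, rfl⟩, rfl⟩ := Set.mem_iUnion.1 hx
      exact ⟨_, ha, rfl⟩
  rw [h]
  exact isOpen_iUnion fun S => isOpenMap_sigmaMk _
    ((isOpenEmbedding_map S.left).isOpenMap _ (hU.preimage (continuous_mk S)))

end ChartCat

namespace Orbifold

open ChartCat OrbifoldChart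

variable {n : ℕ} {X : Type v} [TopologicalSpace X] (O : Orbifold.{u, v} n X)

/-! ## Loops of the groupoid of an orbifold -/

/-- The disjoint union of the fixed point sets `V_p^g` for all `p` and all `g ∈ G_p`. -/
abbrev FixedPt : Type (max u v) :=
  Σ j : (Σ p, (O.chart p).G), {x : (O.chart j.1).V // j.2 • x = x}

/-- The loop `[id, x, λ_g]` at a point `x ∈ V_p^g`. -/
noncomputable def loopOfFixed (d : O.FixedPt) : O.groupoid.Loop :=
  O.fixedLoop d.1.1 d.1.2 d.2.1 d.2.2

/-- A common refinement is again an embedding of a chart, and embeddings distinguish the elements of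
the target group. The germ at one point therefore already determines `g`. -/
theorem mk_translate_eq_iff {p : X} {A : OrbifoldChart.{u, v} n X} {q : X} {l : A ⟶ O.chart p}
    {r : A ⟶ O.chart q} {a : A.V} {g h : (O.chart q).G} :
    (Quot.mk _ ⟨⟨p, q, A, l, r ≫ (O.chart q).translate g⟩, a⟩ : SpanArr O.chart) =
      Quot.mk _ ⟨⟨p, q, A, l, r ≫ (O.chart q).translate h⟩, a⟩ ↔ g = h := by
  rw [mk_eq_mk_iff_right]
  constructor
  · rintro ⟨B, ν, b, -, e⟩
    exact Embedding.translate_injective (ν ≫ r) (by simpa only [Category.assoc] using e)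
  · rintro rfl
    exact ⟨A, 𝟙 A, a, rfl, rfl⟩

theorem continuous_loopOfFixed : Continuous O.loopOfFixed :=
  continuous_sigma fun j => Continuous.subtype_mk
    ((continuous_mk (V := O.chart) ⟨j.1, j.1, O.chart j.1, 𝟙 _, (O.chart j.1).translate j.2⟩).comp
      continuous_subtype_val) _

/-- The map `x ↦ [id, x, λ_g]` is open from all of `V_p` into the arrows, and its value at `x` is a
loop only if `g x = x`; the image of an open part of `V_p^g` is the trace on the loops of an open
set of arrows. -/
theorem isOpenMap_loopOfFixed : IsOpenMap O.loopOfFixed := by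
  rw [isOpenMap_sigma]
  rintro ⟨p, g⟩ U hU
  obtain ⟨U', hU', rfl⟩ := isOpen_induced_iff.1 hU
  have h1 := isOpenMap_mk (V := O.chart) ⟨p, p, O.chart p, 𝟙 _, (O.chart p).translate g⟩ U' hU'
  refine (congrArg IsOpen (Set.Subset.antisymm ?_ ?_)).mpr (h1.preimage continuous_subtype_val)
  · rintro _ ⟨x, hx, rfl⟩
    exact ⟨x.1, hx, rfl⟩
  · rintro ⟨v, hv⟩ ⟨x, hx, rfl⟩
    change (O.chart p).V at x
    have h2 : (⟨p, x⟩ : Σ p, (O.chart p).V) = ⟨p, g • x⟩ := hv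
    exact ⟨⟨x, (eq_of_heq (Sigma.mk.inj_iff.1 h2).2).symm⟩, hx, rfl⟩

theorem loopOfFixed_injective : Function.Injective O.loopOfFixed := by
  rintro ⟨⟨p, g⟩, x, hx⟩ ⟨⟨q, h⟩, y, hy⟩ e
  have h1 : (⟨p, x⟩ : Σ p, (O.chart p).V) = ⟨q, y⟩ :=
    congrArg (fun l : O.groupoid.Loop => O.groupoid.src l.1) e
  cases h1
  have h2 : g = h := (O.mk_translate_eq_iff (l := 𝟙 _) (r := 𝟙 _) (a := x)).1 (by
    rw [Category.id_comp, Category.id_comp]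
    exact congrArg Subtype.val e)
  subst h2
  rfl

/-- Both legs of a loop `[l, a, r]` end in the same chart, so `r = λ_g l` and the loop is `[id,
l(a), λ_g]`; equality of source and target says that `g` fixes `l(a)`. -/
theorem loopOfFixed_surjective : Function.Surjective O.loopOfFixed := by
  rintro ⟨a, ha⟩
  induction a using Quot.ind with | _ T
  obtain ⟨⟨p, q, A, l, r⟩, a⟩ := T
  have h1 : (⟨p, l.toFun a⟩ : Σ p, (O.chart p).V) = ⟨q, r.toFun a⟩ := ha
  obtain rfl : p = q := congrArg Sigma.fst h1
  have h2 : l.toFun a = r.toFun a := eq_of_heq (Sigma.mk.inj_iff.1 h1).2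
  obtain ⟨g, rfl⟩ := Embedding.exists_comp_translate l r
  exact ⟨⟨⟨p, g⟩, l.toFun a, h2.symm⟩, Subtype.ext (mk_comp_right (V := O.chart) l _ a).symm⟩

/-- The loops of the groupoid of an orbifold are the points of `⊔ₚ ⊔_{g ∈ G_p} V_p^g`. -/
noncomputable def loopHomeomorph : O.FixedPt ≃ₜ O.groupoid.Loop :=
  Equiv.toHomeomorphOfContinuousOpen
    (Equiv.ofBijective _ ⟨O.loopOfFixed_injective, O.loopOfFixed_surjective⟩)
    O.continuous_loopOfFixed O.isOpenMap_loopOfFixed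

/-- An arrow `[λ₁, w, λ₂]` conjugates the loop of `g` to the loop of `h` if and only if `g` and `h`
come from one element of the group of the chart of `w`. -/
theorem fixedLoop_conj_iff {p q : X} {A : OrbifoldChart.{u, v} n X} (l : A ⟶ O.chart p)
    (r : A ⟶ O.chart q) (a : A.V) {g : (O.chart p).G} {h : (O.chart q).G}
    (hg : g • l.toFun a = l.toFun a) (hh : h • r.toFun a = r.toFun a) :
    (∃ (h₁ : O.groupoid.tgt (O.fixedLoop p g _ hg).1 =
          O.groupoid.src (Quot.mk _ ⟨⟨p, q, A, l, r⟩, a⟩))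
        (h₂ : O.groupoid.tgt (Quot.mk _ ⟨⟨p, q, A, l, r⟩, a⟩) =
          O.groupoid.src (O.fixedLoop q h _ hh).1),
        O.groupoid.comp (O.fixedLoop p g _ hg).1 (Quot.mk _ ⟨⟨p, q, A, l, r⟩, a⟩) h₁ =
          O.groupoid.comp (Quot.mk _ ⟨⟨p, q, A, l, r⟩, a⟩) (O.fixedLoop q h _ hh).1 h₂) ↔
      ∃ k, l.hom k = g ∧ r.hom k = h := by
  -- Since `g` fixes a point of the image of `l`, it comes from a unique `k`, which fixes `a`.
  obtain ⟨k, rfl⟩ := l.exists_hom_eq g a a hg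
  have hk : k • a = a := l.injective ((l.equivariant k a).trans hg)
  have hC : Composite (V := O.chart)
      ⟨⟨p, p, O.chart p, 𝟙 _, (O.chart p).translate (l.hom k)⟩, l.toFun a⟩
      ⟨⟨p, q, A, l, r⟩, a⟩ ⟨⟨p, q, A, l ≫ 𝟙 _, A.translate k ≫ r⟩, a⟩ :=
    Composite.mk _ _ _ _ _ _ _ _ _ _ _ _ _ _ _ rfl hk (Embedding.translate_comp l k).symm
  have hC' : Composite (V := O.chart) ⟨⟨p, q, A, l, r⟩, a⟩
      ⟨⟨q, q, O.chart q, 𝟙 _, (O.chart q).translate h⟩, r.toFun a⟩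
      ⟨⟨p, q, A, 𝟙 _ ≫ l, r ≫ (O.chart q).translate h⟩, a⟩ :=
    Composite.mk _ _ _ _ _ _ _ _ _ _ _ _ _ _ _ rfl rfl
      ((Category.id_comp _).trans (Category.comp_id _).symm)
  -- Both composites now have apex `A` and left leg `l`, with right legs `r` followed by the
  -- translation by `r.hom k` and by `h`; they agree iff `r.hom k = h`.
  rw [Category.comp_id, Embedding.translate_comp] at hC
  rw [Category.id_comp] at hC'
  have e1 := SpanArr.comp_mk hC hC.tgt_eq_src
  have e2 := SpanArr.comp_mk hC' hC'.tgt_eq_src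
  have key := O.mk_translate_eq_iff (l := l) (r := r) (a := a) (g := r.hom k) (h := h)
  constructor
  · rintro ⟨_, _, e⟩
    exact ⟨k, rfl, key.1 (e1.symm.trans (Eq.trans e e2))⟩
  · rintro ⟨k', hk', e⟩
    obtain rfl := l.hom_injective hk'
    exact ⟨hC.tgt_eq_src, hC'.tgt_eq_src, e1.trans (Eq.trans (key.2 e) e2.symm)⟩

/-! ## The inclusion of the twisted sectors -/

variable {O} (R : O.Representatives)

theorem forgetMark_refines {S T : Triple R.marked} (h : Refines S T) :
    Refines (forgetMark R S) (forgetMark R T) := by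
  cases h with
  | mk i j A B l r ν l' r' b a e hl hr =>
    exact Refines.mk _ _ _ _ _ _ ν.emb _ _ _ _ (congrArg Subtype.val e)
      (congrArg MarkedChart.Hom.emb hl) (congrArg MarkedChart.Hom.emb hr)

theorem forgetMark_composite {S T U : Triple R.marked} (h : Composite S T U) :
    Composite (forgetMark R S) (forgetMark R T) (forgetMark R U) := by
  cases h with
  | mk i j k A B D l r m n ν μ a b d ha hb sq =>
    exact Composite.mk _ _ _ _ _ _ _ _ _ _ ν.emb μ.emb _ _ _ (congrArg Subtype.val ha)
      (congrArg Subtype.val hb) (congrArg MarkedChart.Hom.emb sq)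

/-- The arrow `[λ₁, w, λ₂]` of `𝖷` underlying an arrow of the twisted sectors. -/
noncomputable def sectorForget (a : (twistedSectors R).Arr) : O.groupoid.Arr :=
  Quot.map (forgetMark R) (fun _ _ => forgetMark_refines R) a

/-- A point of `V_p^g`, `g` the representative of a class, as a fixed point. -/
def sectorFixed (x : (twistedSectors R).Obj) : O.FixedPt :=
  ⟨⟨x.1.1, R.rep x.1.1 x.1.2⟩, x.2⟩

theorem continuous_sectorForget : Continuous (sectorForget R) :=
  continuous_quot_lift _ <| continuous_sigma fun S =>
    (continuous_mk (V := O.chart)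
      ⟨S.i.1, S.j.1, S.apex.chart, S.left.emb, S.right.emb⟩).comp continuous_subtype_val

theorem continuous_sectorFixed : Continuous (sectorFixed R) :=
  continuous_sigma fun i => continuous_sigmaMk
    (σ := fun j : (Σ p, (O.chart p).G) => {x : (O.chart j.1).V // j.2 • x = x})
    (i := ⟨i.1, R.rep i.1 i.2⟩)

theorem sectorFixed_injective : Function.Injective (sectorFixed R) := by
  rintro ⟨⟨p, c⟩, x⟩ ⟨⟨q, d⟩, y⟩ e
  have h1 : (⟨p, R.rep p c⟩ : Σ p, (O.chart p).G) = ⟨q, R.rep q d⟩ := congrArg Sigma.fst e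
  obtain rfl : p = q := congrArg Sigma.fst h1
  have h2 : R.rep p c = R.rep p d := eq_of_heq (Sigma.mk.inj_iff.1 h1).2
  obtain rfl : c = d := by rw [← R.mk_rep p c, h2, R.mk_rep]
  obtain rfl : x = y := eq_of_heq (Sigma.mk.inj_iff.1 e).2
  rfl

theorem isOpenMap_sectorFixed : IsOpenMap (sectorFixed R) := by
  refine isOpenMap_sigma.2 fun i => isOpenMap_sigmaMk
    (σ := fun j : (Σ p, (O.chart p).G) => {x : (O.chart j.1).V // j.2 • x = x})
    (i := ⟨i.1, R.rep i.1 i.2⟩)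

/-- The mark of the apex is the common element `k` required by `fixedLoop_conj_iff`. -/
theorem sectorForget_conj (a : (twistedSectors R).Arr) :
    ∃ (h₁ : O.groupoid.tgt (O.loopOfFixed (sectorFixed R ((twistedSectors R).src a))).1 =
        O.groupoid.src (sectorForget R a))
      (h₂ : O.groupoid.tgt (sectorForget R a) =
        O.groupoid.src (O.loopOfFixed (sectorFixed R ((twistedSectors R).tgt a))).1),
      O.groupoid.comp (O.loopOfFixed (sectorFixed R ((twistedSectors R).src a))).1
          (sectorForget R a) h₁ =
        O.groupoid.comp (sectorForget R a)
          (O.loopOfFixed (sectorFixed R ((twistedSectors R).tgt a))).1 h₂ := by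
  induction a using Quot.ind with | _ T
  obtain ⟨⟨i, j, A, l, r⟩, a⟩ := T
  exact (O.fixedLoop_conj_iff l.emb r.emb a.1 (MarkedChart.sectorMap l a).2
    (MarkedChart.sectorMap r a).2).2 ⟨A.mark, l.hom_mark, r.hom_mark⟩

/-- The inclusion of the twisted sectors into the inertia groupoid. -/
noncomputable def sectorIncl : TopGroupoid.Hom (twistedSectors R) O.groupoid.inertia where
  obj x := O.loopOfFixed (sectorFixed R x)
  arr a := ⟨(O.loopOfFixed (sectorFixed R ((twistedSectors R).src a)), sectorForget R a,
      O.loopOfFixed (sectorFixed R ((twistedSectors R).tgt a))), sectorForget_conj R a⟩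
  continuous_obj := O.continuous_loopOfFixed.comp (continuous_sectorFixed R)
  continuous_arr := Continuous.subtype_mk
    (((O.continuous_loopOfFixed.comp (continuous_sectorFixed R)).comp
      (twistedSectors R).continuous_src).prodMk ((continuous_sectorForget R).prodMk
    ((O.continuous_loopOfFixed.comp (continuous_sectorFixed R)).comp
      (twistedSectors R).continuous_tgt))) _
  src_arr _ := rfl
  tgt_arr _ := rfl
  arr_one x := Subtype.ext (Prod.ext
    (congrArg (fun y => O.loopOfFixed (sectorFixed R y)) ((twistedSectors R).src_one x))
    (Prod.ext rfl
      (congrArg (fun y => O.loopOfFixed (sectorFixed R y)) ((twistedSectors R).tgt_one x))))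
  arr_inv a := Subtype.ext (Prod.ext
    (congrArg (fun y => O.loopOfFixed (sectorFixed R y)) ((twistedSectors R).src_inv a))
    (Prod.ext (by induction a using Quot.ind; rfl)
      (congrArg (fun y => O.loopOfFixed (sectorFixed R y)) ((twistedSectors R).tgt_inv a))))
  arr_comp a b h := Subtype.ext (Prod.ext
    (congrArg (fun y => O.loopOfFixed (sectorFixed R y)) ((twistedSectors R).src_comp a b h))
    (Prod.ext (by
      obtain ⟨U, S, T, rfl, rfl, hU⟩ := SpanArr.exists_composite a b h
      exact (congrArg (sectorForget R) (SpanArr.comp_mk hU h)).trans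
        (SpanArr.comp_mk (forgetMark_composite R hU) (forgetMark_composite R hU).tgt_eq_src).symm)
      (congrArg (fun y => O.loopOfFixed (sectorFixed R y)) ((twistedSectors R).tgt_comp a b h))))

theorem isOpenEmbedding_sectorIncl_obj : IsOpenEmbedding (sectorIncl R).obj :=
  .of_continuous_injective_isOpenMap (sectorIncl R).continuous_obj
    (O.loopOfFixed_injective.comp (sectorFixed_injective R))
    (O.isOpenMap_loopOfFixed.comp (isOpenMap_sectorFixed R))

/-- A point of the span of charts underlying a span of marked charts lies in the sector as soon as
its image does. -/
theorem mark_smul_eq {A B : MarkedChart.{u, v} n X} (l : A ⟶ B) {a : A.chart.V} {x : B.Sector}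
    (h : l.emb.toFun a = x.1) : A.mark • a = a :=
  (MarkedChart.smul_iff l a).1 (by rw [h]; exact x.2)

/-- The element `k` supplied by `fixedLoop_conj_iff` maps to both representatives, so marking the
apex with it turns the underlying span into a span of marked charts. -/
theorem sectorIncl_full (x y : (twistedSectors R).Obj) (β : O.groupoid.inertia.Arr)
    (hx : O.groupoid.inertia.src β = (sectorIncl R).obj x)
    (hy : O.groupoid.inertia.tgt β = (sectorIncl R).obj y) : ∃ a, (sectorIncl R).arr a = β := by
  obtain ⟨⟨v, α, w⟩, h, h', e⟩ := β
  obtain rfl : v = (sectorIncl R).obj x := hx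
  obtain rfl : w = (sectorIncl R).obj y := hy
  induction α using Quot.ind with | _ T
  obtain ⟨⟨p, q, A, l, r⟩, a⟩ := T
  obtain ⟨⟨p', c⟩, x, hgx⟩ := x
  obtain ⟨⟨q', d⟩, y, hgy⟩ := y
  change (O.chart p').V at x
  change (O.chart q').V at y
  change A.V at a
  change R.rep p' c • x = x at hgx
  change R.rep q' d • y = y at hgy
  have h1 : (⟨p', R.rep p' c • x⟩ : Σ p, (O.chart p).V) = ⟨p, l.toFun a⟩ := h
  have h2 : (⟨q, r.toFun a⟩ : Σ p, (O.chart p).V) = ⟨q', y⟩ := h'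
  obtain rfl : p' = p := congrArg Sigma.fst h1
  obtain rfl : q = q' := congrArg Sigma.fst h2
  obtain rfl : x = l.toFun a := hgx.symm.trans (eq_of_heq (Sigma.mk.inj_iff.1 h1).2)
  obtain rfl : r.toFun a = y := eq_of_heq (Sigma.mk.inj_iff.1 h2).2
  obtain ⟨k, hk, hk'⟩ := (O.fixedLoop_conj_iff l r a hgx hgy).1 ⟨h, h', e⟩
  have ha : k • a = a := l.injective (by
    rw [l.equivariant, hk, hgx])
  exact ⟨Quot.mk _ ⟨⟨⟨p', c⟩, ⟨q, d⟩, ⟨A, k⟩, ⟨l, hk⟩, ⟨r, hk'⟩⟩, ⟨a, ha⟩⟩, rfl⟩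

/-- A common refinement of the underlying triples can be marked: the mark of `A` fixes a point of
the image of `ν`, so it comes from some `k`, and injectivity of the homomorphism of `l'` forces `k`
to map to the mark of `A'`. -/
theorem sectorIncl_arr_injective : Function.Injective (sectorIncl R).arr := by
  intro α β e
  have hs : (twistedSectors R).src α = (twistedSectors R).src β :=
    (isOpenEmbedding_sectorIncl_obj R).injective (congrArg (fun γ => γ.1.1) e)
  have ht : (twistedSectors R).tgt α = (twistedSectors R).tgt β :=
    (isOpenEmbedding_sectorIncl_obj R).injective (congrArg (fun γ => γ.1.2.2) e)
  have hm : sectorForget R α = sectorForget R β := congrArg (fun γ => γ.1.2.1) e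
  induction α using Quot.ind with | _ S
  induction β using Quot.ind with | _ T
  obtain ⟨⟨i, j, A, l, r⟩, a⟩ := S
  obtain ⟨⟨i', j', A', l', r'⟩, a'⟩ := T
  obtain rfl : i = i' := congrArg Sigma.fst hs
  obtain rfl : j = j' := congrArg Sigma.fst ht
  obtain ⟨B, ν, ν', b, hb, hb', hl, hr⟩ := (mk_eq_mk_iff (V := O.chart)).1 hm
  change B.V at b
  change ν.toFun b = a.1 at hb
  change ν'.toFun b = a'.1 at hb'
  obtain ⟨k, hk⟩ := ν.exists_hom_eq A.mark b b (by rw [hb, a.2])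
  have hk' : ν'.hom k = A'.mark := by
    apply l'.emb.hom_injective
    have h1 : l.emb.hom (ν.hom k) = l'.emb.hom (ν'.hom k) :=
      DFunLike.congr_fun (congrArg Embedding.hom hl) k
    rw [← h1, hk, l.hom_mark, l'.hom_mark]
  have hkb : k • b = b := ν.injective (by rw [ν.equivariant, hk, hb, a.2])
  exact (mk_eq_mk_iff (V := R.marked)).2 ⟨⟨B, k⟩, ⟨ν, hk⟩, ⟨ν', hk'⟩, ⟨b, hkb⟩, Subtype.ext hb,
    Subtype.ext hb', MarkedChart.Hom.ext hl, MarkedChart.Hom.ext hr⟩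

/-- Near the image of `[l, a, r]`, three open conditions suffice: the source loop lies in the sector
of `i`, the target loop in that of `j`, and the underlying arrow is `[l, b, r]` with `b` near `a`.
Then `l(b)` is fixed by the representative, so `b` lies in the sector of the apex. -/
theorem isOpenEmbedding_sectorIncl_arr : IsOpenEmbedding (sectorIncl R).arr := by
  refine .of_continuous_injective_isOpenMap (sectorIncl R).continuous_arr
    (sectorIncl_arr_injective R) fun U hU => ?_
  rw [isOpen_iff_mem_nhds]
  rintro _ ⟨α, hα, rfl⟩
  induction α using Quot.ind with | _ S
  obtain ⟨⟨i, j, A, l, r⟩, a⟩ := S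
  -- `N` is open in the whole apex chart and meets the sector in the preimage of `U`.
  obtain ⟨N, hN, hNU⟩ := isOpen_induced_iff.1
    (hU.preimage (continuous_mk (V := R.marked) ⟨i, j, A, l, r⟩))
  have hpiece : ∀ i, IsOpen ((sectorIncl R).obj '' Set.range (Sigma.mk i)) := fun i =>
    (isOpenEmbedding_sectorIncl_obj R).isOpenMap _ isOpen_range_sigmaMk
  have hmid : IsOpen ((fun w : A.chart.V => (Quot.mk _ ⟨⟨i.1, j.1, A.chart, l.emb, r.emb⟩, w⟩ :
      SpanArr O.chart)) '' N) :=
    isOpenMap_mk (V := O.chart) ⟨i.1, j.1, A.chart, l.emb, r.emb⟩ N hN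
  have haN : a.1 ∈ N := (congrArg (a ∈ ·) hNU).mpr hα
  have hopen := ((hpiece i).preimage O.groupoid.inertia.continuous_src).inter
    ((hmid.preimage O.groupoid.continuous_inertia_arr).inter
      ((hpiece j).preimage O.groupoid.inertia.continuous_tgt))
  refine Filter.mem_of_superset (hopen.mem_nhds ⟨⟨_, ⟨_, rfl⟩, rfl⟩, ⟨a.1, haN, rfl⟩,
    ⟨_, ⟨_, rfl⟩, rfl⟩⟩) ?_
  rintro ⟨⟨v, α, w⟩, h, h', e⟩ ⟨⟨_, ⟨x, rfl⟩, rfl⟩, ⟨b, hb, rfl⟩, ⟨_, ⟨y, rfl⟩, rfl⟩⟩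
  change A.chart.V at b
  have h1 : (⟨i.1, (R.marked i).mark • x.1⟩ : Σ p, (O.chart p).V) = ⟨i.1, l.emb.toFun b⟩ := h
  have h2 : (⟨j.1, r.emb.toFun b⟩ : Σ p, (O.chart p).V) = ⟨j.1, y.1⟩ := h'
  have h3 : l.emb.toFun b = x.1 := (eq_of_heq (Sigma.mk.inj_iff.1 h1).2).symm.trans x.2
  have h4 : r.emb.toFun b = y.1 := eq_of_heq (Sigma.mk.inj_iff.1 h2).2
  have hbk := mark_smul_eq l h3
  obtain rfl : MarkedChart.sectorMap l ⟨b, hbk⟩ = x := Subtype.ext h3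
  obtain rfl : MarkedChart.sectorMap r ⟨b, hbk⟩ = y := Subtype.ext h4
  exact ⟨Quot.mk _ ⟨⟨i, j, A, l, r⟩, ⟨b, hbk⟩⟩, (congrArg ((⟨b, hbk⟩ : A.Sector) ∈ ·) hNU).mp hb,
    rfl⟩

/-! ## The retraction of the inertia groupoid onto the twisted sectors -/

theorem exists_conj_rep (p : X) (g : (O.chart p).G) :
    ∃ z, z * g * z⁻¹ = R.rep p (ConjClasses.mk g) := by
  have h : IsConj g (R.rep p (ConjClasses.mk g)) :=
    ConjClasses.mk_eq_mk_iff_isConj.1 (R.mk_rep p _).symm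
  exact isConj_iff.1 h

/-- An element conjugating `g` to the representative of its class. -/
noncomputable def conjRep (p : X) (g : (O.chart p).G) : (O.chart p).G :=
  (exists_conj_rep R p g).choose

theorem conjRep_spec (p : X) (g : (O.chart p).G) :
    conjRep R p g * g * (conjRep R p g)⁻¹ = R.rep p (ConjClasses.mk g) :=
  (exists_conj_rep R p g).choose_spec

/-- The translation `V_p^g → V_p^h` onto the sector of the representative `h` of the class
of `g`. -/
noncomputable def conjHom (p : X) (g : (O.chart p).G) :
    (⟨O.chart p, g⟩ : MarkedChart.{u, v} n X) ⟶ R.marked ⟨p, ConjClasses.mk g⟩ :=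
  ⟨(O.chart p).translate (conjRep R p g), conjRep_spec R p g⟩

/-- The retraction `⊔_g V_p^g → ⊔_{(g)} V_p^g`. -/
noncomputable def fixedRetract (d : O.FixedPt) : (twistedSectors R).Obj :=
  ⟨⟨d.1.1, ConjClasses.mk d.1.2⟩, MarkedChart.sectorMap (conjHom R d.1.1 d.1.2) d.2⟩

theorem continuous_fixedRetract : Continuous (fixedRetract R) :=
  continuous_sigma fun j => (continuous_sigmaMk (σ := fun i => (R.marked i).Sector)
    (i := ⟨j.1, ConjClasses.mk j.2⟩)).comp
    (MarkedChart.isOpenEmbedding_sectorMap (conjHom R j.1 j.2)).continuous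

theorem isOpenMap_fixedRetract : IsOpenMap (fixedRetract R) :=
  isOpenMap_sigma.2 fun j => (isOpenMap_sigmaMk (σ := fun i => (R.marked i).Sector)
    (i := ⟨j.1, ConjClasses.mk j.2⟩)).comp
    (MarkedChart.isOpenEmbedding_sectorMap (conjHom R j.1 j.2)).isOpenMap

/-- The arrow of the inertia groupoid from the loop of a fixed point to its retraction. -/
noncomputable def retractArrow (d : O.FixedPt) : O.groupoid.inertia.Arr :=
  ⟨(O.loopOfFixed d, Quot.mk _ ⟨⟨d.1.1, d.1.1, O.chart d.1.1, 𝟙 _,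
      (O.chart d.1.1).translate (conjRep R d.1.1 d.1.2)⟩, d.2.1⟩,
      (sectorIncl R).obj (fixedRetract R d)),
    (O.fixedLoop_conj_iff (𝟙 _) ((O.chart d.1.1).translate (conjRep R d.1.1 d.1.2)) d.2.1 d.2.2
      (fixedRetract R d).2.2).2 ⟨d.1.2, rfl, conjRep_spec R d.1.1 d.1.2⟩⟩

/-- The conjugating element depends only on `p` and `g`, hence is constant on each piece of the
disjoint union; this is why arbitrary choices are allowed. -/
theorem continuous_retractArrow : Continuous (retractArrow R) :=
  Continuous.subtype_mk (O.continuous_loopOfFixed.prodMk (Continuous.prodMk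
    (continuous_sigma fun j => (continuous_mk (V := O.chart) ⟨j.1, j.1, O.chart j.1, 𝟙 _,
      (O.chart j.1).translate (conjRep R j.1 j.2)⟩).comp continuous_subtype_val)
    ((sectorIncl R).continuous_obj.comp (continuous_fixedRetract R)))) _

theorem exists_isMorita_inertia_sectors :
    ∃ M : TopGroupoid.Hom O.groupoid.inertia (twistedSectors R), M.IsMorita :=
  (sectorIncl R).exists_isMorita_of_retraction (isOpenEmbedding_sectorIncl_obj R).injective
    (isOpenEmbedding_sectorIncl_arr R).isEmbedding (sectorIncl_full R)
    (fun v => fixedRetract R (O.loopHomeomorph.symm v))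
    ((continuous_fixedRetract R).comp O.loopHomeomorph.symm.continuous)
    ((isOpenMap_fixedRetract R).comp O.loopHomeomorph.symm.isOpenMap)
    (fun v => retractArrow R (O.loopHomeomorph.symm v))
    ((continuous_retractArrow R).comp O.loopHomeomorph.symm.continuous)
    (fun v => O.loopHomeomorph.apply_symm_apply v) (fun _ => rfl) SpanArr.isOpenMap_src

/-! ## The twisted sectors over one chart -/

/-- The source of an arrow recovers the class and the point, and the underlying arrow of the
orbifold groupoid recovers `z`. -/
theorem isOpenEmbedding_sectorArrow (p : X) : IsOpenEmbedding (sectorArrow R p) := by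
  refine .of_continuous_injective_isOpenMap
    (continuous_sigma fun j => continuous_mk (V := R.marked) ⟨⟨p, j.1⟩, ⟨p, j.1⟩,
      R.marked ⟨p, j.1⟩, 𝟙 _, (R.marked ⟨p, j.1⟩).translate j.2⟩) ?_
    (isOpenMap_sigma.2 fun j => isOpenMap_mk (V := R.marked) ⟨⟨p, j.1⟩, ⟨p, j.1⟩,
      R.marked ⟨p, j.1⟩, 𝟙 _, (R.marked ⟨p, j.1⟩).translate j.2⟩)
  rintro ⟨⟨c, z⟩, x⟩ ⟨⟨d, z'⟩, y⟩ e
  have h1 : (⟨⟨p, c⟩, x⟩ : Σ i, (R.marked i).Sector) = ⟨⟨p, d⟩, y⟩ :=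
    congrArg (twistedSectors R).src e
  cases h1
  have h2 : z.1 = z'.1 := (O.mk_translate_eq_iff (l := 𝟙 _) (r := 𝟙 _) (a := x.1)).1 (by
    rw [Category.id_comp, Category.id_comp]
    exact congrArg (sectorForget R) e)
  obtain rfl : z = z' := Subtype.ext h2
  rfl

theorem range_sectorArrow (p : X) : Set.range (sectorArrow R p) =
    {a | ((twistedSectors R).src a).1.1 = p ∧ ((twistedSectors R).tgt a).1.1 = p} := by
  refine Set.Subset.antisymm ?_ ?_
  · rintro _ ⟨a, rfl⟩
    exact ⟨rfl, rfl⟩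
  · rintro α ⟨hs, ht⟩
    induction α using Quot.ind with | _ S
    obtain ⟨⟨⟨q, c⟩, ⟨q', d⟩, A, l, r⟩, a⟩ := S
    obtain rfl : q = p := hs
    obtain rfl : q' = q := ht
    obtain ⟨z, hz⟩ : ∃ z : (O.chart q').G, l.emb ≫ (O.chart q').translate z = r.emb :=
      Embedding.exists_comp_translate l.emb r.emb
    have h1 : z * R.rep q' c * z⁻¹ = R.rep q' d := by
      have h2 : r.emb.hom A.mark = (l.emb ≫ (O.chart q').translate z).hom A.mark :=
        (DFunLike.congr_fun (congrArg Embedding.hom hz) A.mark).symm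
      exact ((congrArg (fun g : (O.chart q').G => z * g * z⁻¹)
        (show (l.emb.hom A.mark : (O.chart q').G) = R.rep q' c from l.hom_mark)).symm.trans
        h2.symm).trans r.hom_mark
    -- As `z` conjugates one chosen representative to the other, the classes agree; each class has
    -- one representative, so `z` centralizes it.
    obtain rfl : c = d := by
      rw [← R.mk_rep q' c, ← R.mk_rep q' d, ConjClasses.mk_eq_mk_iff_isConj]
      exact isConj_iff.2 ⟨z, h1⟩
    have hzc : z ∈ Subgroup.centralizer {(R.marked ⟨q', c⟩).mark} :=
      Subgroup.mem_centralizer_singleton_iff.2 (mul_inv_eq_iff_eq_mul.1 h1)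
    have hr : l ≫ (R.marked ⟨q', c⟩).translate ⟨z, hzc⟩ = r := MarkedChart.Hom.ext hz
    subst hr
    exact ⟨⟨⟨c, ⟨z, hzc⟩⟩, MarkedChart.sectorMap l a⟩,
      (mk_comp_right (V := R.marked) l _ a).symm⟩

end Orbifold

/-! ### Assembly of the three statements -/

open TopGroupoid in
theorem mainTheorem12 (n : ℕ) (X : Type v) [TopologicalSpace X] [T2Space X] [ParacompactSpace X]
    (O : Orbifold.{u, v} n X) (R : O.Representatives) :
    -- the inertia groupoid is Morita equivalent to the twisted sectors
    MoritaEquivalent O.groupoid.inertia (Orbifold.twistedSectors R) ∧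
    -- the twisted sectors are a subgroupoid of the inertia groupoid, via
    -- `(x, g) ↦ [id, x, λ_g]` on objects and `[λ₁, w, λ₂] ↦ [λ₁, w, λ₂]` on arrows,
    -- and the inertia groupoid has a Morita morphism to them
    (∃ (ι : Hom (Orbifold.twistedSectors R) O.groupoid.inertia)
        (M : Hom O.groupoid.inertia (Orbifold.twistedSectors R)),
      ι.IsSubgroupoidEmbedding ∧
      (∀ (p : X) (c : ConjClasses (O.chart p).G) (x : (R.marked ⟨p, c⟩).Sector),
        ι.obj ⟨⟨p, c⟩, x⟩ = O.fixedLoop p (R.rep p c) x.1 x.2) ∧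
      (∀ T : ChartCat.Triple R.marked,
        (ι.arr (Quot.mk _ T)).1.2.1 = Quot.mk _ (Orbifold.forgetMark R T)) ∧
      M.IsMorita) ∧
    -- over each chart `V_p` the twisted sectors are `⊔_{(g)} V_p^g × C(g) ⇉ ⊔_{(g)} V_p^g`
    (∀ p : X, IsOpenEmbedding (Orbifold.sectorArrow R p) ∧
      Set.range (Orbifold.sectorArrow R p) =
        {a | ((Orbifold.twistedSectors R).src a).1.1 = p ∧
          ((Orbifold.twistedSectors R).tgt a).1.1 = p}) := by
  obtain ⟨M, hM⟩ := Orbifold.exists_isMorita_inertia_sectors R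
  -- The middle groupoid of the Morita equivalence is the inertia groupoid itself.
  exact ⟨⟨O.groupoid.inertia, Hom.id _, M, Hom.isMorita_id _
      (O.groupoid.isOpenMap_inertia_src ChartCat.SpanArr.isOpenMap_src), hM⟩,
    ⟨Orbifold.sectorIncl R, M, ⟨(Orbifold.isOpenEmbedding_sectorIncl_obj R).isEmbedding,
      (Orbifold.isOpenEmbedding_sectorIncl_arr R).isEmbedding⟩, fun _ _ _ => rfl, fun _ => rfl, hM⟩,
    fun p => ⟨Orbifold.isOpenEmbedding_sectorArrow R p, Orbifold.range_sectorArrow R p⟩⟩
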